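/- **Setting.** Let $\mathfrak H$ be a separable complex Hilbert space, let $A_0$ be a self-adjoint operator in $\mathfrak H$ and let $B_2$ be a closed operator in $\mathfrak H$ such that the operator $S=A_0\cap B_2$, that is, $Sf=A_0f=B_2f$ on $$\operatorname{dom}(S)=\{f\in\operatorname{dom}(A_0)\cap\operatorname{dom}(B_2)\;:\;A_0f=B_2f\},$$ is densely defined (so $S$ is closed and symmetric, and $B_2$ is densely defined), and such that $S=A_0\cap B_2^*$. Let $\{\mathcal G,\Gamma_0,\Gamma_1\}$ be a boundary triple for $S^*$: $\mathcal G$ is a complex Hilbert space and $\Gamma_0,\Gamma_1:\operatorname{dom}(S^*)\to\mathcal G$ are linear maps such that $(S^*f,g)-(f,S^*g)=(\Gamma_1f,\Gamma_0g)-(\Gamma_0f,\Gamma_1g)$ for all $f,g\in\operatorname{dom}(S^*)$ and $(\Gamma_0,\Gamma_1):\operatorname{dom}(S^*)\to\mathcal G\times\mathcal G$ is onto. Let $\Theta_2$ be a densely defined closed operator in $\mathcal G$, and suppose that $$A_0=S^*\upharpoonright\ker(\Gamma_0),\qquad B_2=S^*\upharpoonright\ker(\Gamma_1-\Theta_2\Gamma_0),$$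 where $\ker(\Gamma_1-\Theta_2\Gamma_0)=\{f\in\operatorname{dom}(S^*):\Gamma_0f\in\operatorname{dom}(\Theta_2),\ \Gamma_1f=\Theta_2\Gamma_0f\}$. Let $M(z)=\Gamma_1\big(\Gamma_0\upharpoonright\ker(S^*-z)\big)^{-1}\in\mathcal B(\mathcal G)$, $z\in\rho(A_0)$, be the corresponding Weyl--Titchmarsh function. For a closed operator $T$, the discrete spectrum $\sigma_d(T)$ is the set of eigenvalues of $T$ that are isolated in $\sigma(T)$ and have finite algebraic multiplicity, in the sense that the Riesz projection $-\frac1{2\pi i}\oint_{C(z;\varepsilon)}(T-\zeta)^{-1}d\zeta$ has finite rank for small $\varepsilon>0$; $m_a(z;T)$ is the dimension of the algebraic eigenspace $\bigcup_n\ker((T-z)^n)$, so that $m_a(z;T)=0$ if $z\in\rho(T)$. A $\mathcal B(\mathcal G)$-valued function $F$ is finitely meromorphic on an open set $\Omega$ if near each $z_1\in\Omega$ one has $F(z)=\sum_{k=1}^{N}(z-z_1)^{-k}F_{-k}+g(z)$ for $z\neq z_1$, with finite rank operators $F_{-k}$ and $g$ analytic at $z_1$. **Statement.** Let $z_0\in\mathbb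 C$ satisfy $$z_0\in\sigma_d(B_2)\cup\rho(B_2)\quad\text{and}\quad z_0\in\sigma_d(A_0)\cup\rho(A_0).$$ Then there exists $\varepsilon_0>0$ such that, with $\Omega=D(z_0;\varepsilon_0)$ the open disc and $\mathcal D_0=\{z_0\}$, the function $F(\cdot)=\Theta_2-M(\cdot)$ on $\Omega\setminus\mathcal D_0$ has densely defined closed operators in $\mathcal G$ as values and satisfies the index hypothesis: 1. $\operatorname{dom}(F(z))$ does not depend on $z\in\Omega\setminus\mathcal D_0$; 2. $F(z)^{-1}\in\mathcal B(\mathcal G)$ for all $z\in\Omega\setminus\mathcal D_0$; 3. $F(\cdot)^{-1}$ is analytic on $\Omega\setminus\mathcal D_0$ and finitely meromorphic on $\Omega$; 4. $z\mapsto F(z)\varphi$ is analytic on $\Omega\setminus\mathcal D_0$ for every $\varphi$ in the common domain; 5. for $z\in\Omega\setminus\mathcal D_0$ the operator $F'(z):\varphi\mapsto\frac{d}{dz}F(z)\varphi$ on the common domain extends to a bounded operator $\overline{F'(z)}\in\mathcal B(\mathcal G)$, and $\overline{F'(\cdot)}$ is analytic on $\Omega\setminus\mathcal D_0$ and finitely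 meromorphic on $\Omega$. Moreover, for all $0<\varepsilon<\varepsilon_0$ the operator $\frac1{2\pi i}\oint_{C(z_0;\varepsilon)}\overline{F'(\zeta)}F(\zeta)^{-1}d\zeta$ has finite rank, and its trace, the generalized index $\widetilde{\operatorname{ind}}_{C(z_0;\varepsilon)}(\Theta_2-M(\cdot))$, satisfies $$\widetilde{\operatorname{ind}}_{C(z_0;\varepsilon)}\big(\Theta_2-M(\cdot)\big)=m_a(z_0;B_2)-m_a(z_0;A_0).$$ -/

import Mathlib

noncomputable section

namespace GenIndex

open Filter Topology

section Operators

variable {E : Type*} [NormedAddCommGroup E] [InnerProductSpace ℂ E]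

/-- The operator `T - z I`, with domain `dom T`. -/
def subScalar (T : E →ₗ.[ℂ] E) (z : ℂ) : E →ₗ.[ℂ] E :=
  ⟨T.domain, T.toFun - z • T.domain.subtype⟩

/-- `R` is the everywhere defined, bounded inverse of the operator `A : dom A → E`:
`A x = y` (with `x ∈ dom A`) if and only if `x = R y`. -/
def IsBoundedInverse (A : E →ₗ.[ℂ] E) (R : E →L[ℂ] E) : Prop :=
  ∀ x y : E, (x, y) ∈ A.graph ↔ R y = x

/-- `A` is boundedly invertible: `A⁻¹ ∈ 𝓑(E)`. -/
def BoundedlyInvertible (A : E →ₗ.[ℂ] E) : Prop :=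
  ∃ R : E →L[ℂ] E, IsBoundedInverse A R

open scoped Classical in
/-- The bounded operator `A⁻¹` (and `0` if `A` is not boundedly invertible). -/
def boundedInverse (A : E →ₗ.[ℂ] E) : E →L[ℂ] E :=
  if h : BoundedlyInvertible A then h.choose else 0

/-- The resolvent set `ρ(T)`. -/
def resolventSet (T : E →ₗ.[ℂ] E) : Set ℂ :=
  {z | BoundedlyInvertible (subScalar T z)}

/-- The bounded operator `T` has finite rank. -/
def FiniteRank (T : E →L[ℂ] E) : Prop :=
  FiniteDimensional ℂ (LinearMap.range T.toLinearMap)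

/-- The trace of a finite rank operator `T`, i.e. the trace of the endomorphism that `T` induces on
its (finite-dimensional) range. -/
def finiteRankTrace (T : E →L[ℂ] E) : ℂ :=
  LinearMap.trace ℂ (LinearMap.range T.toLinearMap)
    (T.toLinearMap.restrict fun x _ => LinearMap.mem_range_self T.toLinearMap x)

/-- The Riesz projection `-(2πi)⁻¹ ∮_{C(z₀;ε)} (T - ζ)⁻¹ dζ`. -/
def rieszProjection (T : E →ₗ.[ℂ] E) (z₀ : ℂ) (ε : ℝ) : E →L[ℂ] E :=
  -((2 * Real.pi * Complex.I : ℂ)⁻¹ • ∮ ζ in C(z₀, ε), boundedInverse (subScalar T ζ))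

/-- `ker (T - z)ⁿ`, where `(T - z)ⁿ` has its natural domain. -/
def kerPow (T : E →ₗ.[ℂ] E) (z : ℂ) : ℕ → Submodule ℂ E
  | 0 => ⊥
  | n + 1 => ((kerPow T z n).comap (subScalar T z).toFun).map (subScalar T z).domain.subtype

/-- The algebraic eigenspace `⋃ₙ ker (T - z)ⁿ`. -/
def algebraicEigenspace (T : E →ₗ.[ℂ] E) (z : ℂ) : Submodule ℂ E :=
  ⨆ n, kerPow T z n

/-- The algebraic multiplicity `m_a(z; T)`, the dimension of the algebraic eigenspace;
it is `0` if `z ∈ ρ(T)`. -/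
def algMult (T : E →ₗ.[ℂ] E) (z : ℂ) : ℕ :=
  Module.finrank ℂ (algebraicEigenspace T z)

/-- The discrete spectrum `σ_d(T)`: the eigenvalues of `T` that are isolated in the spectrum and
have finite algebraic multiplicity. As usual for operators that need not be normal, finiteness of
the multiplicity of an isolated point of the spectrum means that the Riesz projection has finite
rank (its range is then the algebraic eigenspace). -/
def discreteSpectrum (T : E →ₗ.[ℂ] E) : Set ℂ :=
  {z | (∃ x : T.domain, (x : E) ≠ 0 ∧ T x = z • (x : E)) ∧
    ∃ ε > 0, (∀ ζ, ζ ≠ z → dist ζ z < ε → ζ ∈ resolventSet T) ∧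
      ∀ r, 0 < r → r < ε → FiniteRank (rieszProjection T z r)}

end Operators

section Index

variable {G : Type*} [NormedAddCommGroup G] [InnerProductSpace ℂ G]

/-- `F` is finitely meromorphic at `z₀`: near `z₀` it is the sum of an analytic function and of a
principal part with finitely many terms, all of whose coefficients have finite rank. -/
def FinitelyMeromorphicAt (F : ℂ → G →L[ℂ] G) (z₀ : ℂ) : Prop :=
  ∃ (N : ℕ) (c : ℕ → G →L[ℂ] G) (g : ℂ → G →L[ℂ] G),
    (∀ k < N, FiniteRank (c k)) ∧ AnalyticAt ℂ g z₀ ∧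
      ∀ᶠ z in 𝓝[≠] z₀, F z = ∑ k ∈ Finset.range N, ((z - z₀) ^ (k + 1))⁻¹ • c k + g z

/-- `F` is finitely meromorphic on `Ω` (at a point that is not a pole there is no principal
part, and the condition says that the singularity is removable). -/
def FinitelyMeromorphicOn (F : ℂ → G →L[ℂ] G) (Ω : Set ℂ) : Prop :=
  ∀ z ∈ Ω, FinitelyMeromorphicAt F z

open scoped Classical in
/-- The value `A x` for `x ∈ dom A` (and `0` otherwise). -/
def value (A : G →ₗ.[ℂ] G) (x : G) : G :=
  if h : x ∈ A.domain then A ⟨x, h⟩ else 0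

/-- `D` is a bounded continuation of the operator `M'(z)`, `φ ↦ (d/dz) M(z) φ`, that is defined
on `dom (M z)`. -/
def IsDerivClosure (M : ℂ → G →ₗ.[ℂ] G) (z : ℂ) (D : G →L[ℂ] G) : Prop :=
  ∀ φ ∈ (M z).domain, D φ = deriv (fun w => value (M w) φ) z

open scoped Classical in
/-- The bounded operator obtained from `M'(z)` by continuation (unique if `dom (M z)` is dense;
`0` if there is none). -/
def derivClosure (M : ℂ → G →ₗ.[ℂ] G) (z : ℂ) : G →L[ℂ] G :=
  if h : ∃ D, IsDerivClosure M z D then h.choose else 0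

/-- The assumptions under which the generalized index of an operator-valued function
`M : Ω \ D₀ → 𝓒(G)` is defined. -/
structure IndexHypothesis (Ω D₀ : Set ℂ) (M : ℂ → G →ₗ.[ℂ] G) : Prop where
  isOpen : IsOpen Ω
  isConnected : IsConnected Ω
  subset : D₀ ⊆ Ω
  /-- `D₀` has no limit points in `Ω` -/
  discrete : ∀ z ∈ Ω, ¬ AccPt z (𝓟 D₀)
  /-- the values of `M` are closed and densely defined -/
  closed : ∀ z ∈ Ω \ D₀, (M z).IsClosed
  dense : ∀ z ∈ Ω \ D₀, Dense ((M z).domain : Set G)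
  /-- (i) -/
  domain_eq : ∀ z ∈ Ω \ D₀, ∀ w ∈ Ω \ D₀, (M z).domain = (M w).domain
  /-- (ii) -/
  invertible : ∀ z ∈ Ω \ D₀, BoundedlyInvertible (M z)
  /-- (iii) -/
  inv_analytic : AnalyticOnNhd ℂ (fun z => boundedInverse (M z)) (Ω \ D₀)
  inv_finMero : FinitelyMeromorphicOn (fun z => boundedInverse (M z)) Ω
  /-- (iv) -/
  analytic : ∀ φ, (∀ z ∈ Ω \ D₀, φ ∈ (M z).domain) →
    AnalyticOnNhd ℂ (fun z => value (M z) φ) (Ω \ D₀)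
  /-- (v) -/
  deriv_bounded : ∀ z ∈ Ω \ D₀, ∃ D, IsDerivClosure M z D
  deriv_analytic : AnalyticOnNhd ℂ (derivClosure M) (Ω \ D₀)
  deriv_finMero : FinitelyMeromorphicOn (derivClosure M) Ω

/-- The operator `(2πi)⁻¹ ∮_{C(z₀;ε)} M'(ζ) M(ζ)⁻¹ dζ`, with `M'(ζ)` extended by continuity. -/
def indexOperator (M : ℂ → G →ₗ.[ℂ] G) (z₀ : ℂ) (ε : ℝ) : G →L[ℂ] G :=
  (2 * Real.pi * Complex.I : ℂ)⁻¹ •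
    ∮ ζ in C(z₀, ε), derivClosure M ζ ∘L boundedInverse (M ζ)

/-- The generalized index of `M` with respect to the circle `C(z₀;ε)`. -/
def generalizedIndex (M : ℂ → G →ₗ.[ℂ] G) (z₀ : ℂ) (ε : ℝ) : ℂ :=
  finiteRankTrace (indexOperator M z₀ ε)

end Index

section BoundaryTriples

variable {H : Type*} [NormedAddCommGroup H] [InnerProductSpace ℂ H]
variable {G : Type*} [NormedAddCommGroup G] [InnerProductSpace ℂ G]

/-- The restriction of `T` to a subspace of its domain. -/
def restrictTo (T : H →ₗ.[ℂ] H) (L : Submodule ℂ T.domain) : H →ₗ.[ℂ] H :=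
  T.domRestrict (L.map T.domain.subtype)

/-- A boundary triple `{G, Γ₀, Γ₁}` for the operator `T` (which is `S*` in the applications):
the abstract Green identity holds and `(Γ₀, Γ₁) : dom T → G × G` is onto. The inner product of
Mathlib is linear in the second entry, hence the order of the arguments. -/
structure BoundaryTriple (T : H →ₗ.[ℂ] H) (G : Type*) [NormedAddCommGroup G]
    [InnerProductSpace ℂ G] where
  Γ₀ : T.domain →ₗ[ℂ] G
  Γ₁ : T.domain →ₗ[ℂ] G
  green : ∀ f g : T.domain,
    inner ℂ (g : H) (T f) - inner ℂ (T g) (f : H) =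
      inner ℂ (Γ₀ g) (Γ₁ f) - inner ℂ (Γ₁ g) (Γ₀ f)
  surjective : Function.Surjective (Γ₀.prod Γ₁)

namespace BoundaryTriple

variable {T : H →ₗ.[ℂ] H}

/-- The extension `T ↾ ker Γ₀`. -/
def extZero (b : BoundaryTriple T G) : H →ₗ.[ℂ] H :=
  restrictTo T (LinearMap.ker b.Γ₀)

/-- The extension `T ↾ ker (Γ₁ - Θ Γ₀)`, that is, the restriction of `T` to all `f ∈ dom T` such
that `Γ₀ f ∈ dom Θ` and `Γ₁ f = Θ Γ₀ f`. -/
def ext (b : BoundaryTriple T G) (Θ : G →ₗ.[ℂ] G) : H →ₗ.[ℂ] H :=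
  restrictTo T (Θ.graph.comap (b.Γ₀.prod b.Γ₁))

/-- The Weyl--Titchmarsh function `M(z) = Γ₁ (Γ₀ ↾ ker (T - z))⁻¹`: the operator with graph
`{(Γ₀ f, Γ₁ f) | f ∈ ker (T - z)}`. -/
def weyl (b : BoundaryTriple T G) (z : ℂ) : G →ₗ.[ℂ] G :=
  ((LinearMap.ker (T.toFun - z • T.domain.subtype)).map (b.Γ₀.prod b.Γ₁)).toLinearPMap

end BoundaryTriple

end BoundaryTriples

end GenIndex

end

/-! Write `R_A(z)`, `R_B(z)` for the resolvents of `A₀` and `B₂`, `γ(z)` for the solution operator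
that sends `φ` to the `f` in `ker (S* - z)` with `Γ₀ f = φ`, and `F = Θ₂ - M`. Green's identity and
the closed graph theorem make `γ(z)`, `M(z)`, `Γ₁ R_A(z)` and `Γ₀ R_B(z)` bounded. Two identities
carry the proof: `M'(z) = Γ₁ R_A(z) γ(z)` (`hasDerivAt_weylOp`) and Krein's formula `R_B(z) - R_A(z)
= γ(z) F(z)⁻¹ Γ₁ R_A(z)` (`resolventOp_sub_resolventOp`). With `a = Γ₁ R_A` and `c = γ F⁻¹` they say
`F' F⁻¹ = -a c` and `R_B - R_A = c a`.

The factors `a` and `c` are finitely meromorphic at `z₀`: each is obtained from a resolvent by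
composing with fixed bounded operators and analytic functions, and the resolvents are finitely
meromorphic at a point of the discrete spectrum (`isFinMeroAt_resolventOp_of_finiteRank`). For such
factors the residues of `a c` and `c a` have finite rank and equal trace
(`IsFinMeroAt.eventually_residueTraceComm`). Hence the index is minus the trace of the residue of
`R_B - R_A`. The residue of a resolvent is minus the Riesz projection, whose trace is its rank, and
its range is the algebraic eigenspace (`algebraicEigenspace_eq_range_rieszProjection`). This gives
`m_a(z₀; B₂) - m_a(z₀; A₀)`. -/

noncomputable section

namespace GenIndex

open Filter Topology

/-! ### Finite rank operators and their traces -/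

section FiniteRankOperators

variable {E F K : Type*} [NormedAddCommGroup E] [InnerProductSpace ℂ E]
  [NormedAddCommGroup F] [InnerProductSpace ℂ F] [NormedAddCommGroup K] [InnerProductSpace ℂ K]

/-- A bounded operator between two spaces has finite rank. -/
def HasFiniteRank (T : E →L[ℂ] F) : Prop :=
  FiniteDimensional ℂ (LinearMap.range T.toLinearMap)

theorem HasFiniteRank.of_range_le {T : E →L[ℂ] F} (V : Submodule ℂ F) [FiniteDimensional ℂ V]
    (h : ∀ x, T x ∈ V) : HasFiniteRank T := by
  have : LinearMap.range T.toLinearMap ≤ V := by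
    rintro _ ⟨x, rfl⟩
    exact h x
  exact Submodule.finiteDimensional_of_le this

theorem hasFiniteRank_zero : HasFiniteRank (0 : E →L[ℂ] F) :=
  HasFiniteRank.of_range_le ⊥ (by simp)

theorem HasFiniteRank.add {S T : E →L[ℂ] F} (hS : HasFiniteRank S) (hT : HasFiniteRank T) :
    HasFiniteRank (S + T) := by
  have : FiniteDimensional ℂ (LinearMap.range S.toLinearMap) := hS
  have : FiniteDimensional ℂ (LinearMap.range T.toLinearMap) := hT
  refine HasFiniteRank.of_range_le
    (LinearMap.range S.toLinearMap ⊔ LinearMap.range T.toLinearMap) fun x => ?_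
  exact Submodule.add_mem_sup ⟨x, rfl⟩ ⟨x, rfl⟩

theorem HasFiniteRank.smul {T : E →L[ℂ] F} (hT : HasFiniteRank T) (a : ℂ) :
    HasFiniteRank (a • T) := by
  have : FiniteDimensional ℂ (LinearMap.range T.toLinearMap) := hT
  exact HasFiniteRank.of_range_le (LinearMap.range T.toLinearMap) fun x => ⟨a • x, by simp⟩

theorem HasFiniteRank.neg {T : E →L[ℂ] F} (hT : HasFiniteRank T) : HasFiniteRank (-T) := by
  simpa using hT.smul (-1)

theorem HasFiniteRank.comp_right {T : F →L[ℂ] K} (hT : HasFiniteRank T) (S : E →L[ℂ] F) :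
    HasFiniteRank (T ∘L S) := by
  have : FiniteDimensional ℂ (LinearMap.range T.toLinearMap) := hT
  exact HasFiniteRank.of_range_le (LinearMap.range T.toLinearMap) fun x => ⟨S x, rfl⟩

theorem HasFiniteRank.comp_left {T : E →L[ℂ] F} (hT : HasFiniteRank T) (S : F →L[ℂ] K) :
    HasFiniteRank (S ∘L T) := by
  have : FiniteDimensional ℂ (LinearMap.range T.toLinearMap) := hT
  exact HasFiniteRank.of_range_le ((LinearMap.range T.toLinearMap).map S.toLinearMap)
    fun x => ⟨T x, ⟨x, rfl⟩, rfl⟩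

/-- The trace of a finite rank operator can be computed on any finite-dimensional subspace that
contains its range. -/
theorem finiteRankTrace_eq_trace_restrict (T : E →L[ℂ] E) (V : Submodule ℂ E)
    [FiniteDimensional ℂ V] (h : ∀ x, T x ∈ V) :
    finiteRankTrace T = LinearMap.trace ℂ V (T.toLinearMap.restrict fun x _ => h x) := by
  have hle : LinearMap.range T.toLinearMap ≤ V := by
    rintro _ ⟨x, rfl⟩
    exact h x
  have : FiniteDimensional ℂ (LinearMap.range T.toLinearMap) :=
    Submodule.finiteDimensional_of_le hle
  set W := LinearMap.range T.toLinearMap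
  let f : W →ₗ[ℂ] V := Submodule.inclusion hle
  let g : V →ₗ[ℂ] W := (T.toLinearMap.comp V.subtype).codRestrict W fun x => ⟨x, rfl⟩
  -- `T` on `V` is `f g` and `T` on its range is `g f`, so cyclicity of the matrix trace compares
  -- them.
  have h1 : T.toLinearMap.restrict (fun x _ => h x) = f ∘ₗ g := by
    ext x; rfl
  have h2 : T.toLinearMap.restrict
      (fun x _ => LinearMap.mem_range_self T.toLinearMap x : ∀ x ∈ W, _) = g ∘ₗ f := by
    ext x; rfl
  unfold finiteRankTrace
  rw [h1, h2]
  exact LinearMap.trace_comp_comm' f g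

theorem finiteRankTrace_add {S T : E →L[ℂ] E} (hS : HasFiniteRank S) (hT : HasFiniteRank T) :
    finiteRankTrace (S + T) = finiteRankTrace S + finiteRankTrace T := by
  have : FiniteDimensional ℂ (LinearMap.range S.toLinearMap) := hS
  have : FiniteDimensional ℂ (LinearMap.range T.toLinearMap) := hT
  let V := LinearMap.range S.toLinearMap ⊔ LinearMap.range T.toLinearMap
  have h1 : ∀ x, S x ∈ V := fun x => Submodule.mem_sup_left ⟨x, rfl⟩
  have h2 : ∀ x, T x ∈ V := fun x => Submodule.mem_sup_right ⟨x, rfl⟩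
  rw [finiteRankTrace_eq_trace_restrict S V h1, finiteRankTrace_eq_trace_restrict T V h2,
    finiteRankTrace_eq_trace_restrict (S + T) V fun x => V.add_mem (h1 x) (h2 x), ← map_add]
  rfl

theorem finiteRankTrace_smul {T : E →L[ℂ] E} (hT : HasFiniteRank T) (a : ℂ) :
    finiteRankTrace (a • T) = a * finiteRankTrace T := by
  have : FiniteDimensional ℂ (LinearMap.range T.toLinearMap) := hT
  let V := LinearMap.range T.toLinearMap
  have h : ∀ x, T x ∈ V := fun x => ⟨x, rfl⟩
  rw [finiteRankTrace_eq_trace_restrict T V h,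
    finiteRankTrace_eq_trace_restrict (a • T) V fun x => V.smul_mem a (h x), ← smul_eq_mul,
    ← map_smul]
  rfl

theorem finiteRankTrace_neg {T : E →L[ℂ] E} (hT : HasFiniteRank T) :
    finiteRankTrace (-T) = -finiteRankTrace T := by
  simpa using finiteRankTrace_smul hT (-1)

theorem finiteRankTrace_zero : finiteRankTrace (0 : E →L[ℂ] E) = 0 := by
  simpa using finiteRankTrace_smul (hasFiniteRank_zero (E := E) (F := E)) 0

/-- The trace is cyclic if one of the factors has finite rank. -/
theorem finiteRankTrace_comp_comm {S : E →L[ℂ] F} (hS : HasFiniteRank S) (T : F →L[ℂ] E) :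
    finiteRankTrace (S ∘L T) = finiteRankTrace (T ∘L S) := by
  have : FiniteDimensional ℂ (LinearMap.range S.toLinearMap) := hS
  let V := LinearMap.range S.toLinearMap
  let W := V.map T.toLinearMap
  have hV : ∀ x, (S ∘L T) x ∈ V := fun x => ⟨T x, rfl⟩
  have hW : ∀ x, (T ∘L S) x ∈ W := fun x => ⟨S x, ⟨x, rfl⟩, rfl⟩
  rw [finiteRankTrace_eq_trace_restrict _ V hV, finiteRankTrace_eq_trace_restrict _ W hW]
  let f : W →ₗ[ℂ] V := (S.toLinearMap.comp W.subtype).codRestrict V fun x => ⟨x, rfl⟩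
  let g : V →ₗ[ℂ] W := (T.toLinearMap.comp V.subtype).codRestrict W fun x => ⟨x, x.2, rfl⟩
  exact LinearMap.trace_comp_comm' g f

/-- The trace of a finite rank projection is the dimension of its range. -/
theorem finiteRankTrace_of_isIdempotent {P : E →L[ℂ] E} (hP : HasFiniteRank P)
    (h : ∀ x, P (P x) = P x) :
    finiteRankTrace P = (Module.finrank ℂ (LinearMap.range P.toLinearMap) : ℂ) := by
  have : FiniteDimensional ℂ (LinearMap.range P.toLinearMap) := hP
  unfold finiteRankTrace
  have : P.toLinearMap.restrict (fun x _ => LinearMap.mem_range_self P.toLinearMap x) =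
      (LinearMap.id : LinearMap.range P.toLinearMap →ₗ[ℂ] _) := by
    ext ⟨_, x, rfl⟩
    exact h x
  rw [this, LinearMap.trace_id]

end FiniteRankOperators

/-! ### Residues of operator-valued functions -/

section Residues

variable {E : Type*} [NormedAddCommGroup E] [NormedSpace ℂ E]

/-- The normalized integral `(2πi)⁻¹ ∮_{C(z₀;r)} f(ζ) dζ`. -/
def residueIntegral (f : ℂ → E) (z₀ : ℂ) (r : ℝ) : E :=
  (2 * Real.pi * Complex.I : ℂ)⁻¹ • ∮ ζ in C(z₀, r), f ζ

theorem residueIntegral_congr {f g : ℂ → E} {z₀ : ℂ} {r : ℝ} (hr : 0 ≤ r)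
    (h : ∀ z ∈ Metric.sphere z₀ r, f z = g z) :
    residueIntegral f z₀ r = residueIntegral g z₀ r := by
  unfold residueIntegral
  rw [circleIntegral.integral_congr hr h]

theorem residueIntegral_add {f g : ℂ → E} {z₀ : ℂ} {r : ℝ} (hf : CircleIntegrable f z₀ r)
    (hg : CircleIntegrable g z₀ r) :
    residueIntegral (fun z => f z + g z) z₀ r =
      residueIntegral f z₀ r + residueIntegral g z₀ r := by
  unfold residueIntegral
  rw [circleIntegral.integral_add hf hg, smul_add]

theorem residueIntegral_sub {f g : ℂ → E} {z₀ : ℂ} {r : ℝ} (hf : CircleIntegrable f z₀ r)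
    (hg : CircleIntegrable g z₀ r) :
    residueIntegral (fun z => f z - g z) z₀ r =
      residueIntegral f z₀ r - residueIntegral g z₀ r := by
  unfold residueIntegral
  rw [circleIntegral.integral_sub hf hg, smul_sub]

theorem residueIntegral_neg {f : ℂ → E} {z₀ : ℂ} {r : ℝ} :
    residueIntegral (fun z => -f z) z₀ r = -residueIntegral f z₀ r := by
  unfold residueIntegral
  have := circleIntegral.integral_smul (-1 : ℂ) f z₀ r
  simp only [neg_smul, one_smul] at this
  rw [this, smul_neg]

theorem _root_.ContinuousLinearMap.residueIntegral_comp_comm {F : Type*} [NormedAddCommGroup F]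
    [NormedSpace ℂ F] [CompleteSpace E] [CompleteSpace F] (L : E →L[ℂ] F) {f : ℂ → E} {z₀ : ℂ}
    {r : ℝ} (hf : CircleIntegrable f z₀ r) :
    residueIntegral (fun z => L (f z)) z₀ r = L (residueIntegral f z₀ r) := by
  unfold residueIntegral circleIntegral
  rw [map_smul, ← ContinuousLinearMap.intervalIntegral_comp_comm L hf.out]
  simp

theorem residueIntegral_eq_zero {f : ℂ → E} {z₀ : ℂ} {r : ℝ} (hr : 0 ≤ r)
    (hf : DifferentiableOn ℂ f (Metric.closedBall z₀ r)) : residueIntegral f z₀ r = 0 := by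
  unfold residueIntegral
  rw [(hf.diffContOnCl_ball subset_rfl).circleIntegral_eq_zero hr, smul_zero]

theorem residueIntegral_center_inv [CompleteSpace E] (z₀ : ℂ) {r : ℝ} (hr : r ≠ 0) (a : E) :
    residueIntegral (fun z => (z - z₀)⁻¹ • a) z₀ r = a := by
  unfold residueIntegral
  rw [circleIntegral.integral_smul_const, circleIntegral.integral_sub_center_inv _ hr, smul_smul,
    inv_mul_cancel₀ Complex.two_pi_I_ne_zero, one_smul]

/-- The integral over a circle around an isolated singularity does not depend on the radius. -/
theorem residueIntegral_eq_of_differentiableOn [CompleteSpace E] {f : ℂ → E} {z₀ : ℂ} {ε : ℝ}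
    (hf : ∀ z, z ≠ z₀ → dist z z₀ < ε → DifferentiableAt ℂ f z) {r s : ℝ} (hr : 0 < r)
    (hrε : r < ε) (hs : 0 < s) (hsε : s < ε) :
    residueIntegral f z₀ r = residueIntegral f z₀ s := by
  wlog h : r ≤ s generalizing r s
  · exact (this hs hsε hr hrε (le_of_not_ge h)).symm
  have hne : ∀ z, z ∉ Metric.ball z₀ r → z ≠ z₀ := by
    rintro z hz rfl
    exact hz (Metric.mem_ball_self hr)
  unfold residueIntegral
  congr 1
  refine (Complex.circleIntegral_eq_of_differentiable_on_annulus_off_countable hr h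
    Set.countable_empty ?_ ?_).symm
  · rintro z ⟨hz, hz'⟩
    exact (hf z (hne z hz') (lt_of_le_of_lt hz hsε)).continuousAt.continuousWithinAt
  · rintro z ⟨⟨hz, hz'⟩, -⟩
    exact hf z (hne z fun h => hz' (Metric.ball_subset_closedBall h)) (lt_trans hz hsε)

end Residues

/-! ### Finitely meromorphic functions -/

section FinitelyMeromorphic

variable {E F K : Type*} [NormedAddCommGroup E] [InnerProductSpace ℂ E]
  [NormedAddCommGroup F] [InnerProductSpace ℂ F] [NormedAddCommGroup K] [InnerProductSpace ℂ K]

/-- A function with values in the bounded operators between two spaces is finitely meromorphic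
at `z₀`. -/
def IsFinMeroAt (f : ℂ → E →L[ℂ] F) (z₀ : ℂ) : Prop :=
  ∃ (N : ℕ) (c : ℕ → E →L[ℂ] F) (g : ℂ → E →L[ℂ] F),
    (∀ k < N, HasFiniteRank (c k)) ∧ AnalyticAt ℂ g z₀ ∧
      ∀ᶠ z in 𝓝[≠] z₀, f z = ∑ k ∈ Finset.range N, ((z - z₀) ^ (k + 1))⁻¹ • c k + g z

variable {z₀ : ℂ}

theorem IsFinMeroAt.congr {f g : ℂ → E →L[ℂ] F} (hf : IsFinMeroAt f z₀)
    (h : ∀ᶠ z in 𝓝[≠] z₀, g z = f z) : IsFinMeroAt g z₀ := by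
  obtain ⟨N, c, k, hc, hk, hf⟩ := hf
  exact ⟨N, c, k, hc, hk, by filter_upwards [h, hf] with z h1 h2 using h1.trans h2⟩

theorem _root_.AnalyticAt.isFinMeroAt {f : ℂ → E →L[ℂ] F} (hf : AnalyticAt ℂ f z₀) :
    IsFinMeroAt f z₀ :=
  ⟨0, 0, f, by simp, hf, by simp⟩

theorem IsFinMeroAt.add {f g : ℂ → E →L[ℂ] F} (hf : IsFinMeroAt f z₀) (hg : IsFinMeroAt g z₀) :
    IsFinMeroAt (fun z => f z + g z) z₀ := by
  obtain ⟨N, c, k, hc, hk, hf⟩ := hf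
  obtain ⟨N', c', k', hc', hk', hg⟩ := hg
  -- The shorter principal part is padded with zeros; coefficients beyond `N` and `N'` are arbitrary
  -- and must be discarded.
  refine ⟨max N N', fun i => (if i < N then c i else 0) + (if i < N' then c' i else 0),
    fun z => k z + k' z, fun i _ => ?_, hk.add hk', ?_⟩
  · refine HasFiniteRank.add ?_ ?_
    · split_ifs with h
      exacts [hc i h, hasFiniteRank_zero]
    · split_ifs with h
      exacts [hc' i h, hasFiniteRank_zero]
  · filter_upwards [hf, hg] with z h1 h2
    have key : ∀ (N M : ℕ) (c : ℕ → E →L[ℂ] F), N ≤ M →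
        ∑ i ∈ Finset.range M, ((z - z₀) ^ (i + 1))⁻¹ • (if i < N then c i else 0) =
          ∑ i ∈ Finset.range N, ((z - z₀) ^ (i + 1))⁻¹ • c i := by
      intro N M c hNM
      rw [← Finset.sum_subset (Finset.range_mono hNM)]
      · exact Finset.sum_congr rfl fun i hi => by rw [if_pos (Finset.mem_range.1 hi)]
      · intro i _ hi
        rw [if_neg (by simpa using hi), smul_zero]
    simp only [smul_add, Finset.sum_add_distrib]
    rw [key _ _ c (le_max_left _ _), key _ _ c' (le_max_right _ _), h1, h2]
    abel

theorem isFinMeroAt_sum {ι : Type*} (s : Finset ι) {f : ι → ℂ → E →L[ℂ] F}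
    (hf : ∀ i ∈ s, IsFinMeroAt (f i) z₀) : IsFinMeroAt (fun z => ∑ i ∈ s, f i z) z₀ := by
  classical
  induction s using Finset.induction_on with
  | empty => simpa using analyticAt_const.isFinMeroAt
  | insert i s hi ih =>
    simp only [Finset.sum_insert hi]
    exact (hf i (by simp)).add (ih fun j hj => hf j (by simp [hj]))

theorem HasFiniteRank.isFinMeroAt_inv_pow_smul {A : E →L[ℂ] F} (hA : HasFiniteRank A) (k : ℕ) :
    IsFinMeroAt (fun z => ((z - z₀) ^ k)⁻¹ • A) z₀ := by
  cases k with
  | zero => simpa using analyticAt_const.isFinMeroAt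
  | succ k =>
    refine ⟨k + 1, fun i => if i = k then A else 0, 0, fun i _ => ?_, analyticAt_const, ?_⟩
    · dsimp only
      split_ifs
      exacts [hA, hasFiniteRank_zero]
    · refine Eventually.of_forall fun z => ?_
      simp

/-- If `L` takes finite rank operators as values and `h` is analytic, then `(z - z₀)⁻ᵏ L (h z)` is
finitely meromorphic. -/
theorem isFinMeroAt_inv_pow_smul_of_analyticAt {X : Type*} [NormedAddCommGroup X]
    [NormedSpace ℂ X] [CompleteSpace X] (L : X →L[ℂ] E →L[ℂ] F) (hL : ∀ x, HasFiniteRank (L x))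
    (k : ℕ) {h : ℂ → X} (hh : AnalyticAt ℂ h z₀) :
    IsFinMeroAt (fun z => ((z - z₀) ^ k)⁻¹ • L (h z)) z₀ := by
  induction k generalizing h with
  | zero =>
    have : AnalyticAt ℂ (fun z => L (h z)) z₀ := (L.analyticAt (h z₀)).comp hh
    simpa using this.isFinMeroAt
  | succ k ih =>
    -- Splitting off the value `h z₀` leaves `(z - z₀)` times the analytic divided difference, which
    -- lowers the order of the pole by one.
    have hd : AnalyticAt ℂ (dslope h z₀) z₀ := by
      obtain ⟨s, hs, hsd⟩ := Filter.eventually_iff_exists_mem.1 hh.eventually_analyticAt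
      refine DifferentiableOn.analyticAt (s := s) ?_ hs
      rw [Complex.differentiableOn_dslope hs]
      exact fun z hz => (hsd z hz).differentiableAt.differentiableWithinAt
    refine (((hL (h z₀)).isFinMeroAt_inv_pow_smul (k + 1)).add (ih hd)).congr ?_
    filter_upwards [self_mem_nhdsWithin] with z hz
    have hz' : z - z₀ ≠ 0 := sub_ne_zero.2 hz
    have : h z = h z₀ + (z - z₀) • dslope h z₀ z := by
      rw [sub_smul_dslope]; abel
    rw [this, map_add, smul_add, map_smul, smul_smul]
    congr 2
    field_simp
    ring

/-- This treats one term of the principal part of the left factor of a product. The finite rank of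
`A` also makes the polar coefficients coming from the analytic part of `f` of finite rank. -/
theorem IsFinMeroAt.const_comp_inv_pow_smul [CompleteSpace F] {A : F →L[ℂ] K}
    (hA : HasFiniteRank A) (k : ℕ) {f : ℂ → E →L[ℂ] F} (hf : IsFinMeroAt f z₀) :
    IsFinMeroAt (fun z => (((z - z₀) ^ k)⁻¹ • A) ∘L f z) z₀ := by
  obtain ⟨N, c, g, hc, hg, hf⟩ := hf
  have h1 : IsFinMeroAt (fun z => ∑ i ∈ Finset.range N,
      ((z - z₀) ^ (k + (i + 1)))⁻¹ • (A ∘L c i)) z₀ :=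
    isFinMeroAt_sum _ fun i _ => (hA.comp_right (c i)).isFinMeroAt_inv_pow_smul _
  have h2 : IsFinMeroAt (fun z => ((z - z₀) ^ k)⁻¹ • (A ∘L g z)) z₀ :=
    isFinMeroAt_inv_pow_smul_of_analyticAt (ContinuousLinearMap.compL ℂ E F K A)
      (fun x => hA.comp_right x) k hg
  refine (h1.add h2).congr ?_
  filter_upwards [hf] with z hz
  rw [hz, ContinuousLinearMap.comp_add, ContinuousLinearMap.comp_finsetSum]
  simp [smul_smul, pow_add, mul_comm]

theorem _root_.AnalyticAt.clm_comp {h : ℂ → F →L[ℂ] K} {g : ℂ → E →L[ℂ] F} {z : ℂ}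
    (hh : AnalyticAt ℂ h z) (hg : AnalyticAt ℂ g z) :
    AnalyticAt ℂ (fun z => h z ∘L g z) z :=
  AnalyticAt.comp (g := fun p : (F →L[ℂ] K) × (E →L[ℂ] F) => p.1 ∘L p.2)
    (f := fun z => (h z, g z))
    ((ContinuousLinearMap.compL ℂ E F K).analyticAt_bilinear (h z, g z)) (hh.prod hg)

/-- The products `h z ∘L c i` have finite rank but depend on `z`, so they are expanded at `z₀` until
the pole is used up. -/
theorem IsFinMeroAt.analytic_comp [CompleteSpace K] {h : ℂ → F →L[ℂ] K} (hh : AnalyticAt ℂ h z₀)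
    {f : ℂ → E →L[ℂ] F} (hf : IsFinMeroAt f z₀) : IsFinMeroAt (fun z => h z ∘L f z) z₀ := by
  obtain ⟨N, c, g, hc, hg, hf⟩ := hf
  have h1 : IsFinMeroAt (fun z => ∑ i ∈ Finset.range N,
      ((z - z₀) ^ (i + 1))⁻¹ • (h z ∘L c i)) z₀ :=
    isFinMeroAt_sum _ fun i hi => isFinMeroAt_inv_pow_smul_of_analyticAt
      ((ContinuousLinearMap.compL ℂ E F K).flip (c i))
      (fun x => (hc i (Finset.mem_range.1 hi)).comp_left x) _ hh
  have h2 : AnalyticAt ℂ (fun z => h z ∘L g z) z₀ :=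
    hh.clm_comp hg
  refine (h1.add h2.isFinMeroAt).congr ?_
  filter_upwards [hf] with z hz
  rw [hz, ContinuousLinearMap.comp_add, ContinuousLinearMap.comp_finsetSum]
  simp

theorem IsFinMeroAt.comp [CompleteSpace F] [CompleteSpace K] {f : ℂ → F →L[ℂ] K}
    {g : ℂ → E →L[ℂ] F} (hf : IsFinMeroAt f z₀) (hg : IsFinMeroAt g z₀) :
    IsFinMeroAt (fun z => f z ∘L g z) z₀ := by
  obtain ⟨N, c, h, hc, hh, hf⟩ := hf
  refine ((isFinMeroAt_sum (Finset.range N) fun i hi =>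
    hg.const_comp_inv_pow_smul (hc i (Finset.mem_range.1 hi)) (i + 1)).add
      (hg.analytic_comp hh)).congr ?_
  filter_upwards [hf] with z hz
  rw [hz, ContinuousLinearMap.add_comp, ContinuousLinearMap.finsetSum_comp]

theorem IsFinMeroAt.neg [CompleteSpace F] {f : ℂ → E →L[ℂ] F} (hf : IsFinMeroAt f z₀) :
    IsFinMeroAt (fun z => -f z) z₀ := by
  simpa using IsFinMeroAt.analytic_comp
    (analyticAt_const (v := -ContinuousLinearMap.id ℂ F)) hf

/-! ### Traces of residues of products -/

theorem eventually_forall_mem_sphere {p : ℂ → Prop} (h : ∀ᶠ z in 𝓝[≠] z₀, p z) :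
    ∀ᶠ r in 𝓝[>] (0 : ℝ), ∀ z ∈ Metric.sphere z₀ r, p z := by
  rw [eventually_nhdsWithin_iff, Metric.eventually_nhds_iff] at h
  obtain ⟨ε, hε, h⟩ := h
  filter_upwards [Ioo_mem_nhdsGT hε] with r hr z hz
  refine h (by rw [Metric.mem_sphere.1 hz]; exact hr.2) ?_
  rintro rfl
  simp at hz
  exact hr.1.ne hz

theorem eventually_forall_mem_closedBall {p : ℂ → Prop} (h : ∀ᶠ z in 𝓝 z₀, p z) :
    ∀ᶠ r in 𝓝[>] (0 : ℝ), ∀ z ∈ Metric.closedBall z₀ r, p z := by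
  rw [Metric.eventually_nhds_iff] at h
  obtain ⟨ε, hε, h⟩ := h
  filter_upwards [Ioo_mem_nhdsGT hε] with r hr z hz
  exact h (lt_of_le_of_lt hz hr.2)

/-- The residue integrals of `a c` and of `c a` have finite rank and the same trace. -/
def ResidueTraceComm (a : ℂ → E →L[ℂ] F) (c : ℂ → F →L[ℂ] E) (z₀ : ℂ) (r : ℝ) : Prop :=
  HasFiniteRank (residueIntegral (fun z => a z ∘L c z) z₀ r) ∧
    HasFiniteRank (residueIntegral (fun z => c z ∘L a z) z₀ r) ∧
    finiteRankTrace (residueIntegral (fun z => a z ∘L c z) z₀ r) =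
      finiteRankTrace (residueIntegral (fun z => c z ∘L a z) z₀ r)

variable {r : ℝ}

theorem ResidueTraceComm.symm {a : ℂ → E →L[ℂ] F} {c : ℂ → F →L[ℂ] E}
    (h : ResidueTraceComm a c z₀ r) : ResidueTraceComm c a z₀ r :=
  ⟨h.2.1, h.1, h.2.2.symm⟩

theorem circleIntegrable_clm_comp (hr : 0 ≤ r) {a : ℂ → F →L[ℂ] K} {c : ℂ → E →L[ℂ] F}
    (ha : ContinuousOn a (Metric.sphere z₀ r)) (hc : ContinuousOn c (Metric.sphere z₀ r)) :
    CircleIntegrable (fun z => a z ∘L c z) z₀ r :=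
  ContinuousOn.circleIntegrable hr (ha.clm_comp hc)

theorem ResidueTraceComm.congr (hr : 0 ≤ r) {a a' : ℂ → E →L[ℂ] F} {c c' : ℂ → F →L[ℂ] E}
    (h : ResidueTraceComm a c z₀ r) (ha : ∀ z ∈ Metric.sphere z₀ r, a' z = a z)
    (hc : ∀ z ∈ Metric.sphere z₀ r, c' z = c z) : ResidueTraceComm a' c' z₀ r := by
  unfold ResidueTraceComm at *
  rwa [residueIntegral_congr (f := fun z => a' z ∘L c' z) (g := fun z => a z ∘L c z) hr
      fun z hz => by rw [ha z hz, hc z hz],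
    residueIntegral_congr (f := fun z => c' z ∘L a' z) (g := fun z => c z ∘L a z) hr
      fun z hz => by rw [ha z hz, hc z hz]]

theorem ResidueTraceComm.add_left (hr : 0 ≤ r) {a a' : ℂ → E →L[ℂ] F} {c : ℂ → F →L[ℂ] E}
    (h : ResidueTraceComm a c z₀ r) (h' : ResidueTraceComm a' c z₀ r)
    (ha : ContinuousOn a (Metric.sphere z₀ r)) (ha' : ContinuousOn a' (Metric.sphere z₀ r))
    (hc : ContinuousOn c (Metric.sphere z₀ r)) :
    ResidueTraceComm (fun z => a z + a' z) c z₀ r := by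
  unfold ResidueTraceComm at *
  simp only [ContinuousLinearMap.add_comp, ContinuousLinearMap.comp_add]
  rw [residueIntegral_add (circleIntegrable_clm_comp hr ha hc)
      (circleIntegrable_clm_comp hr ha' hc),
      residueIntegral_add (circleIntegrable_clm_comp hr hc ha)
      (circleIntegrable_clm_comp hr hc ha'), finiteRankTrace_add h.1 h'.1,
      finiteRankTrace_add h.2.1 h'.2.1, h.2.2, h'.2.2]
  exact ⟨h.1.add h'.1, h.2.1.add h'.2.1, rfl⟩

theorem residueTraceComm_zero_left (c : ℂ → F →L[ℂ] E) :
    ResidueTraceComm (fun _ => (0 : E →L[ℂ] F)) c z₀ r := by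
  have h1 : residueIntegral (fun z => (0 : E →L[ℂ] F) ∘L c z) z₀ r = 0 := by
    simp [residueIntegral, circleIntegral]
  have h2 : residueIntegral (fun z => c z ∘L (0 : E →L[ℂ] F)) z₀ r = 0 := by
    simp [residueIntegral, circleIntegral]
  refine ⟨?_, ?_, ?_⟩
  · rw [h1]; exact hasFiniteRank_zero
  · rw [h2]; exact hasFiniteRank_zero
  · rw [h1, h2, finiteRankTrace_zero, finiteRankTrace_zero]

theorem residueTraceComm_sum_left (hr : 0 ≤ r) {ι : Type*} (s : Finset ι)
    {a : ι → ℂ → E →L[ℂ] F} {c : ℂ → F →L[ℂ] E} (h : ∀ i ∈ s, ResidueTraceComm (a i) c z₀ r)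
    (ha : ∀ i ∈ s, ContinuousOn (a i) (Metric.sphere z₀ r))
    (hc : ContinuousOn c (Metric.sphere z₀ r)) :
    ResidueTraceComm (fun z => ∑ i ∈ s, a i z) c z₀ r := by
  classical
  induction s using Finset.induction_on with
  | empty => simpa using residueTraceComm_zero_left c
  | insert i s hi ih =>
    simp only [Finset.sum_insert hi]
    refine (h i (by simp)).add_left hr (ih (fun j hj => h j (by simp [hj]))
      fun j hj => ha j (by simp [hj])) (ha i (by simp)) ?_ hc
    exact continuousOn_finsetSum _ fun j hj => ha j (by simp [hj])

/-- The constant `A` leaves the integral on its own side, so the two residues are `A X` and `X A`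
with the same bounded `X`. -/
theorem residueTraceComm_smul_const_left [CompleteSpace E] [CompleteSpace F] (hr : 0 ≤ r)
    {f : ℂ → ℂ} {A : E →L[ℂ] F} {c : ℂ → F →L[ℂ] E} (hA : HasFiniteRank A)
    (hf : ContinuousOn f (Metric.sphere z₀ r)) (hc : ContinuousOn c (Metric.sphere z₀ r)) :
    ResidueTraceComm (fun z => f z • A) c z₀ r := by
  have hi : CircleIntegrable (fun z => f z • c z) z₀ r := (hf.smul hc).circleIntegrable hr
  have h1 : residueIntegral (fun z => (f z • A) ∘L c z) z₀ r =
      A ∘L residueIntegral (fun z => f z • c z) z₀ r := by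
    rw [← ContinuousLinearMap.compL_apply, ← ContinuousLinearMap.residueIntegral_comp_comm _ hi]
    simp
  have h2 : residueIntegral (fun z => c z ∘L (f z • A)) z₀ r =
      residueIntegral (fun z => f z • c z) z₀ r ∘L A := by
    have := ContinuousLinearMap.residueIntegral_comp_comm
      ((ContinuousLinearMap.compL ℂ E F E).flip A) hi
    simpa using this
  unfold ResidueTraceComm
  rw [h1, h2]
  exact ⟨hA.comp_right _, hA.comp_left _, finiteRankTrace_comp_comm hA _⟩

theorem residueTraceComm_of_differentiableOn (hr : 0 ≤ r) {a : ℂ → E →L[ℂ] F}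
    {c : ℂ → F →L[ℂ] E} (ha : DifferentiableOn ℂ a (Metric.closedBall z₀ r))
    (hc : DifferentiableOn ℂ c (Metric.closedBall z₀ r)) : ResidueTraceComm a c z₀ r := by
  have h1 := residueIntegral_eq_zero hr (ha.clm_comp hc)
  have h2 := residueIntegral_eq_zero hr (hc.clm_comp ha)
  unfold ResidueTraceComm
  rw [h1, h2, finiteRankTrace_zero, finiteRankTrace_zero]
  exact ⟨hasFiniteRank_zero, hasFiniteRank_zero, rfl⟩

/-- The residues of the products `a c` and `c a` of two finitely meromorphic functions have finite
rank and the same trace. -/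
theorem IsFinMeroAt.eventually_residueTraceComm [CompleteSpace E] [CompleteSpace F]
    {a : ℂ → E →L[ℂ] F} {c : ℂ → F →L[ℂ] E} (ha : IsFinMeroAt a z₀) (hc : IsFinMeroAt c z₀) :
    ∀ᶠ r in 𝓝[>] (0 : ℝ), ResidueTraceComm a c z₀ r := by
  obtain ⟨N, A, g, hA, hg, ha⟩ := ha
  obtain ⟨N', C, h, hC, hh, hc⟩ := hc
  filter_upwards [eventually_forall_mem_sphere ha, eventually_forall_mem_sphere hc,
    eventually_forall_mem_closedBall hg.eventually_analyticAt,
    eventually_forall_mem_closedBall hh.eventually_analyticAt, self_mem_nhdsWithin]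
    with r ha hc hg hh hr
  have hr : 0 < r := hr
  have hgd : DifferentiableOn ℂ g (Metric.closedBall z₀ r) := fun z hz =>
    (hg z hz).differentiableAt.differentiableWithinAt
  have hhd : DifferentiableOn ℂ h (Metric.closedBall z₀ r) := fun z hz =>
    (hh z hz).differentiableAt.differentiableWithinAt
  have hgc : ContinuousOn g (Metric.sphere z₀ r) :=
    hgd.continuousOn.mono Metric.sphere_subset_closedBall
  have hhc : ContinuousOn h (Metric.sphere z₀ r) :=
    hhd.continuousOn.mono Metric.sphere_subset_closedBall
  have hs : ∀ k : ℕ, ContinuousOn (fun z => ((z - z₀) ^ (k + 1))⁻¹) (Metric.sphere z₀ r) := by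
    intro k
    refine ContinuousOn.inv₀ (by fun_prop) fun z hz => pow_ne_zero _ (sub_ne_zero.2 ?_)
    rintro rfl
    simp at hz
    exact hr.ne hz
  have hpp : ∀ (N : ℕ) (A : ℕ → E →L[ℂ] F), ContinuousOn
      (fun z => ∑ k ∈ Finset.range N, ((z - z₀) ^ (k + 1))⁻¹ • A k) (Metric.sphere z₀ r) :=
    fun N A => continuousOn_finsetSum _ fun k _ => (hs k).smul continuousOn_const
  have hpp' : ∀ (N : ℕ) (A : ℕ → F →L[ℂ] E), ContinuousOn
      (fun z => ∑ k ∈ Finset.range N, ((z - z₀) ^ (k + 1))⁻¹ • A k) (Metric.sphere z₀ r) :=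
    fun N A => continuousOn_finsetSum _ fun k _ => (hs k).smul continuousOn_const
  have hcc := (hpp' N' C).add hhc
  -- The product splits into (principal part of `a`) times `c`, `g` times (principal part of `c`),
  -- and `g` times `h`. The first two contain a constant finite rank factor, and the last has no
  -- residue.
  have key1 := residueTraceComm_sum_left hr.le (Finset.range N)
    (fun k hk => residueTraceComm_smul_const_left hr.le (hA k (Finset.mem_range.1 hk)) (hs k) hcc)
    (fun k _ => (hs k).smul continuousOn_const) hcc
  have key2 := residueTraceComm_sum_left hr.le (Finset.range N')
    (fun k hk => residueTraceComm_smul_const_left hr.le (hC k (Finset.mem_range.1 hk)) (hs k) hgc)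
    (fun k _ => (hs k).smul continuousOn_const) hgc
  have key3 := (key2.add_left hr.le (residueTraceComm_of_differentiableOn hr.le hhd hgd)
    (hpp' N' C) hhc hgc).symm
  exact (key1.add_left hr.le key3 (hpp N A) hgc hcc).congr hr.le ha hc

end FinitelyMeromorphic

/-! ### Resolvents -/

section Resolvents

variable {E : Type*} [NormedAddCommGroup E] [InnerProductSpace ℂ E]

theorem IsBoundedInverse.boundedInverse_eq {A : E →ₗ.[ℂ] E} {R : E →L[ℂ] E}
    (h : IsBoundedInverse A R) : boundedInverse A = R := by
  have hA : BoundedlyInvertible A := ⟨R, h⟩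
  rw [boundedInverse, dif_pos hA]
  ext y
  exact (hA.choose_spec (R y) y).1 ((h (R y) y).2 rfl)

/-- Phrasing everything through the graph of `T` keeps elements of domains out of the resolvent
calculus. -/
theorem mem_graph_subScalar {T : E →ₗ.[ℂ] E} {z : ℂ} {x y : E} :
    (x, y) ∈ (subScalar T z).graph ↔ (x, y + z • x) ∈ T.graph := by
  simp only [LinearPMap.mem_graph_iff, subScalar]
  constructor
  · rintro ⟨u, rfl, hu⟩
    refine ⟨u, rfl, ?_⟩
    rw [← hu]
    change T u = (T u - z • (u : E)) + z • (u : E)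
    abel
  · rintro ⟨u, rfl, hu⟩
    refine ⟨u, rfl, ?_⟩
    change T u - z • (u : E) = y
    rw [hu]
    abel

/-- The resolvent `(T - z)⁻¹`. -/
def resolventOp (T : E →ₗ.[ℂ] E) (z : ℂ) : E →L[ℂ] E :=
  boundedInverse (subScalar T z)

variable {T : E →ₗ.[ℂ] E} {z w : ℂ}

theorem mem_resolventSet_of_forall {R : E →L[ℂ] E}
    (h : ∀ x y, (x, y + z • x) ∈ T.graph ↔ R y = x) :
    z ∈ resolventSet T ∧ resolventOp T z = R := by
  have : IsBoundedInverse (subScalar T z) R := fun x y => by rw [mem_graph_subScalar, h]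
  exact ⟨⟨R, this⟩, this.boundedInverse_eq⟩

theorem resolventOp_apply_eq_iff (hz : z ∈ resolventSet T) {x y : E} :
    resolventOp T z y = x ↔ (x, y + z • x) ∈ T.graph := by
  obtain ⟨R, hR⟩ := hz
  rw [resolventOp, hR.boundedInverse_eq, ← hR, mem_graph_subScalar]

theorem mem_graph_resolventOp (hz : z ∈ resolventSet T) (y : E) :
    (resolventOp T z y, y + z • resolventOp T z y) ∈ T.graph :=
  (resolventOp_apply_eq_iff hz).1 rfl

theorem resolventOp_sub_smul (hz : z ∈ resolventSet T) {x y : E} (h : (x, y) ∈ T.graph) :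
    resolventOp T z (y - z • x) = x :=
  (resolventOp_apply_eq_iff hz).2 (by simpa using h)

theorem resolventOp_injective (hz : z ∈ resolventSet T) {y : E} (h : resolventOp T z y = 0) :
    y = 0 := by
  have := mem_graph_resolventOp hz y
  rw [h, smul_zero, add_zero] at this
  exact T.graph_fst_eq_zero_snd this rfl

/-- The first resolvent identity. -/
theorem resolventOp_sub (hz : z ∈ resolventSet T) (hw : w ∈ resolventSet T) :
    resolventOp T z - resolventOp T w = (z - w) • (resolventOp T z ∘L resolventOp T w) := by
  ext y
  have := resolventOp_sub_smul hz (mem_graph_resolventOp hw y)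
  simp only [map_sub, map_add, map_smul] at this
  simp only [sub_apply, smul_apply,
    ContinuousLinearMap.comp_apply, sub_smul]
  linear_combination (norm := module) this

theorem resolventOp_comm (hz : z ∈ resolventSet T) (hw : w ∈ resolventSet T) :
    resolventOp T z ∘L resolventOp T w = resolventOp T w ∘L resolventOp T z := by
  rcases eq_or_ne z w with rfl | h
  · rfl
  have h1 := resolventOp_sub hz hw
  have h2 := resolventOp_sub hw hz
  have h3 : (z - w) • (resolventOp T z ∘L resolventOp T w) =
      (z - w) • (resolventOp T w ∘L resolventOp T z) := by
    rw [← h1, ← neg_sub w z, neg_smul, ← h2, neg_sub]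
  exact smul_right_injective _ (sub_ne_zero.2 h) h3

/-- The Neumann series representation of the resolvent. -/
theorem resolventOp_eq_inverse [CompleteSpace E] (hw : w ∈ resolventSet T)
    (h : ‖(z - w) • resolventOp T w‖ < 1) : z ∈ resolventSet T ∧
      resolventOp T z = Ring.inverse (1 - (z - w) • resolventOp T w) ∘L resolventOp T w := by
  have hU : IsUnit (1 - (z - w) • resolventOp T w) := isUnit_one_sub_of_norm_lt_one h
  refine mem_resolventSet_of_forall fun x y => ?_
  -- Applying the resolvent at `w` turns `(T - z) x = y` into a bounded equation.
  have h1 : (x, y + z • x) ∈ T.graph ↔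
      resolventOp T w y = (1 - (z - w) • resolventOp T w) x := by
    have : y + z • x = (y + (z - w) • x) + w • x := by
      rw [sub_smul]; abel
    rw [this, ← resolventOp_apply_eq_iff hw]
    simp only [map_add, map_smul, sub_apply, one_apply_eq_self,
      smul_apply]
    exact eq_sub_iff_add_eq.symm
  rw [h1]
  constructor
  · intro h
    rw [ContinuousLinearMap.comp_apply, h, ← mul_apply_eq_comp,
      Ring.inverse_mul_cancel _ hU]
    rfl
  · intro h
    rw [← h, ContinuousLinearMap.comp_apply, ← mul_apply_eq_comp,
      Ring.mul_inverse_cancel _ hU]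
    rfl

theorem eventually_resolventOp_eq_inverse [CompleteSpace E] (hw : w ∈ resolventSet T) :
    ∀ᶠ z in 𝓝 w, z ∈ resolventSet T ∧
      resolventOp T z = Ring.inverse (1 - (z - w) • resolventOp T w) ∘L resolventOp T w := by
  have hc : ContinuousAt (fun z => ‖(z - w) • resolventOp T w‖) w := by fun_prop
  have := hc.eventually_lt (continuousAt_const (y := (1 : ℝ))) (by simp)
  filter_upwards [this] with z hz using resolventOp_eq_inverse hw hz

theorem analyticAt_resolventOp [CompleteSpace E] (hw : w ∈ resolventSet T) :
    AnalyticAt ℂ (resolventOp T) w := by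
  have h1 : AnalyticAt ℂ (fun z => 1 - (z - w) • resolventOp T w) w :=
    analyticAt_const.sub ((analyticAt_id.sub analyticAt_const).smul analyticAt_const)
  have h2 : AnalyticAt ℂ (fun z => Ring.inverse (1 - (z - w) • resolventOp T w)) w := by
    have h3 : AnalyticAt ℂ (Ring.inverse : (E →L[ℂ] E) → E →L[ℂ] E)
        (1 - (w - w) • resolventOp T w) := by
      simpa using analyticAt_inverse (𝕜 := ℂ) (1 : (E →L[ℂ] E)ˣ)
    exact AnalyticAt.comp (f := fun z => 1 - (z - w) • resolventOp T w) h3 h1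
  refine (h2.clm_comp (analyticAt_const (v := resolventOp T w))).congr ?_
  filter_upwards [eventually_resolventOp_eq_inverse hw] with z hz using hz.2.symm

theorem mem_kerPow_succ {n : ℕ} {x : E} :
    x ∈ kerPow T z (n + 1) ↔ ∃ y ∈ kerPow T z n, (x, y + z • x) ∈ T.graph := by
  simp only [kerPow, Submodule.mem_map, Submodule.mem_comap]
  constructor
  · rintro ⟨u, hu, rfl⟩
    exact ⟨_, hu, mem_graph_subScalar.1 (LinearPMap.mem_graph _ u)⟩
  · rintro ⟨y, hy, h⟩
    obtain ⟨u, rfl, hu⟩ := (LinearPMap.mem_graph_iff _).1 (mem_graph_subScalar.2 h)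
    exact ⟨u, by rw [show y = subScalar T z u from hu.symm] at hy; exact hy, rfl⟩

theorem algebraicEigenspace_eq_bot (hz : z ∈ resolventSet T) : algebraicEigenspace T z = ⊥ := by
  refine iSup_eq_bot.2 fun n => ?_
  induction n with
  | zero => rfl
  | succ n ih =>
    refine (Submodule.eq_bot_iff _).2 fun x hx => ?_
    obtain ⟨y, hy, h⟩ := mem_kerPow_succ.1 hx
    rw [ih, Submodule.mem_bot] at hy
    rw [← (resolventOp_apply_eq_iff hz).2 h, hy, map_zero]

end Resolvents

/-! ### Isolated points of the spectrum -/

section Nilpotent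

/-- An endomorphism of a finite-dimensional complex space without nonzero eigenvalues is
nilpotent. -/
theorem isNilpotent_of_forall_eigenvector {V : Type*} [AddCommGroup V] [Module ℂ V]
    [FiniteDimensional ℂ V] (N : Module.End ℂ V)
    (h : ∀ (μ : ℂ) (v : V), N v = μ • v → μ ≠ 0 → v = 0) :
    ∃ n, N ^ n = 0 := by
  have h1 : Module.End.maxGenEigenspace N 0 = ⊤ := by
    rw [eq_top_iff, ← Module.End.iSup_maxGenEigenspace_eq_top N]
    refine iSup_le fun μ => ?_
    rcases eq_or_ne μ 0 with rfl | hμ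
    · exact le_rfl
    · have : Module.End.maxGenEigenspace N μ = ⊥ := by
        rw [Submodule.eq_bot_iff]
        intro v hv
        -- By induction on the length of the chain, `(N - μ) v = 0`, and then `v` vanishes by
        -- hypothesis.
        obtain ⟨k, hk⟩ := Module.End.mem_maxGenEigenspace N μ v |>.1 hv
        induction k generalizing v with
        | zero => simpa using hk
        | succ k ih =>
          have h2 : (N - μ • 1) v = 0 := by
            refine ih _ ?_ (by rw [← Module.End.mul_apply, ← pow_succ, hk])
            exact Module.End.mem_maxGenEigenspace N μ _ |>.2
              ⟨k, by rw [← Module.End.mul_apply, ← pow_succ, hk]⟩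
          refine h μ v ?_ hμ
          rw [← sub_eq_zero]
          simpa using h2
      rw [this]
      exact bot_le
  refine ⟨Module.finrank ℂ V, ?_⟩
  ext v
  have hv : v ∈ Module.End.maxGenEigenspace N 0 := by rw [h1]; trivial
  rw [Module.End.maxGenEigenspace_eq_genEigenspace_finrank, Module.End.mem_genEigenspace_nat] at hv
  simpa using hv

end Nilpotent

/-! ### The Riesz projection and the Laurent expansion of the resolvent -/

section RieszProjection

variable {E : Type*} [NormedAddCommGroup E] [InnerProductSpace ℂ E]
  {T : E →ₗ.[ℂ] E} {z₀ : ℂ} {ε r : ℝ}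

theorem ne_center_of_mem_sphere (hr : 0 < r) {ζ : ℂ} (hζ : ζ ∈ Metric.sphere z₀ r) : ζ ≠ z₀ := by
  rintro rfl
  simp at hζ
  exact hr.ne hζ

theorem mem_resolventSet_of_mem_sphere (hρ : ∀ ζ, ζ ≠ z₀ → dist ζ z₀ < ε → ζ ∈ resolventSet T)
    (hr : 0 < r) (hrε : r < ε) {ζ : ℂ} (hζ : ζ ∈ Metric.sphere z₀ r) : ζ ∈ resolventSet T :=
  hρ ζ (ne_center_of_mem_sphere hr hζ) (by rwa [Metric.mem_sphere.1 hζ])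

variable [CompleteSpace E]

theorem continuousOn_resolventOp_sphere
    (hρ : ∀ ζ, ζ ≠ z₀ → dist ζ z₀ < ε → ζ ∈ resolventSet T) (hr : 0 < r) (hrε : r < ε) :
    ContinuousOn (resolventOp T) (Metric.sphere z₀ r) := fun _ hζ =>
  (analyticAt_resolventOp
    (mem_resolventSet_of_mem_sphere hρ hr hrε hζ)).continuousAt.continuousWithinAt

theorem rieszProjection_eq_neg_residueIntegral :
    rieszProjection T z₀ r = -residueIntegral (resolventOp T) z₀ r := rfl

theorem residueIntegral_resolventOp_eq
    (hρ : ∀ ζ, ζ ≠ z₀ → dist ζ z₀ < ε → ζ ∈ resolventSet T) (hr : 0 < r) (hrε : r < ε) {s : ℝ}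
    (hs : 0 < s) (hsε : s < ε) :
    residueIntegral (resolventOp T) z₀ r = residueIntegral (resolventOp T) z₀ s :=
  residueIntegral_eq_of_differentiableOn
    (fun z hz hzε => (analyticAt_resolventOp (hρ z hz hzε)).differentiableAt) hr hrε hs hsε

theorem resolventOp_comp_rieszProjection
    (hρ : ∀ ζ, ζ ≠ z₀ → dist ζ z₀ < ε → ζ ∈ resolventSet T) (hr : 0 < r) (hrε : r < ε) {w : ℂ}
    (hw : w ∈ resolventSet T) :
    resolventOp T w ∘L rieszProjection T z₀ r = rieszProjection T z₀ r ∘L resolventOp T w := by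
  have hi := (continuousOn_resolventOp_sphere hρ hr hrε).circleIntegrable hr.le
  have h1 := ContinuousLinearMap.residueIntegral_comp_comm
    (ContinuousLinearMap.compL ℂ E E E (resolventOp T w)) hi
  have h2 := ContinuousLinearMap.residueIntegral_comp_comm
    ((ContinuousLinearMap.compL ℂ E E E).flip (resolventOp T w)) hi
  simp only [ContinuousLinearMap.compL_apply, ContinuousLinearMap.flip_apply] at h1 h2
  rw [rieszProjection_eq_neg_residueIntegral, ContinuousLinearMap.comp_neg,
    ContinuousLinearMap.neg_comp, ← h1, ← h2]
  congr 1
  exact residueIntegral_congr hr.le fun ζ hζ =>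
    resolventOp_comm hw (mem_resolventSet_of_mem_sphere hρ hr hrε hζ)

/-- The analytic part of the resolvent at an isolated point of the spectrum. -/
theorem rieszProjection_comp_resolventOp
    (hρ : ∀ ζ, ζ ≠ z₀ → dist ζ z₀ < ε → ζ ∈ resolventSet T) (hr : 0 < r) (hrε : r < ε) {w : ℂ}
    (hw : w ∈ resolventSet T) (hwr : dist w z₀ < r) :
    rieszProjection T z₀ r ∘L resolventOp T w =
      resolventOp T w - residueIntegral (fun ζ => (ζ - w)⁻¹ • resolventOp T ζ) z₀ r := by
  have hc := continuousOn_resolventOp_sphere hρ hr hrε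
  have hi := hc.circleIntegrable hr.le
  have hne : ∀ ζ ∈ Metric.sphere z₀ r, ζ - w ≠ 0 := by
    rintro ζ hζ h
    rw [sub_eq_zero.1 h, Metric.mem_sphere] at hζ
    exact hwr.ne hζ
  have hinv : ContinuousOn (fun ζ => (ζ - w)⁻¹) (Metric.sphere z₀ r) :=
    ContinuousOn.inv₀ (by fun_prop) hne
  have h2 := ContinuousLinearMap.residueIntegral_comp_comm
    ((ContinuousLinearMap.compL ℂ E E E).flip (resolventOp T w)) hi
  simp only [ContinuousLinearMap.compL_apply, ContinuousLinearMap.flip_apply] at h2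
  rw [rieszProjection_eq_neg_residueIntegral, ContinuousLinearMap.neg_comp, ← h2]
  -- The resolvent identity splits the product under the integral; as `w` lies inside the circle,
  -- the term with `resolventOp T w` is reproduced by Cauchy's formula.
  have h3 : residueIntegral (fun ζ => resolventOp T ζ ∘L resolventOp T w) z₀ r =
      residueIntegral
        (fun ζ => (ζ - w)⁻¹ • resolventOp T ζ - (ζ - w)⁻¹ • resolventOp T w) z₀ r := by
    refine residueIntegral_congr hr.le fun ζ hζ => ?_
    rw [← smul_sub, resolventOp_sub (mem_resolventSet_of_mem_sphere hρ hr hrε hζ) hw, smul_smul,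
      inv_mul_cancel₀ (hne ζ hζ), one_smul]
  have h4 : residueIntegral (fun ζ => (ζ - w)⁻¹ • resolventOp T w) z₀ r = resolventOp T w := by
    unfold residueIntegral
    rw [circleIntegral.integral_smul_const, circleIntegral.integral_sub_inv_of_mem_ball hwr,
      smul_smul, inv_mul_cancel₀ Complex.two_pi_I_ne_zero, one_smul]
  have hi1 : CircleIntegrable (fun ζ => (ζ - w)⁻¹ • resolventOp T ζ) z₀ r :=
    (hinv.smul hc).circleIntegrable hr.le
  have hi2 : CircleIntegrable (fun ζ => (ζ - w)⁻¹ • resolventOp T w) z₀ r :=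
    (hinv.smul continuousOn_const).circleIntegrable hr.le
  rw [h3, residueIntegral_sub hi1 hi2, h4, neg_sub]

/-- A Cauchy integral of a continuous function on the circle is analytic in the whole disc,
including `z₀`; this is the regular part of the resolvent. -/
theorem analyticOnNhd_cauchyIntegral_resolventOp
    (hρ : ∀ ζ, ζ ≠ z₀ → dist ζ z₀ < ε → ζ ∈ resolventSet T) (hr : 0 < r) (hrε : r < ε) :
    AnalyticOnNhd ℂ (fun w => residueIntegral (fun ζ => (ζ - w)⁻¹ • resolventOp T ζ) z₀ r)
      (Metric.ball z₀ r) := by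
  have hi := (continuousOn_resolventOp_sphere hρ hr hrε).circleIntegrable hr.le
  lift r to NNReal using hr.le
  have := (hasFPowerSeriesOn_cauchy_integral hi (by exact_mod_cast hr)).analyticOnNhd
  rwa [Metric.eball_coe] at this

/-- By `rieszProjection_comp_resolventOp`, `P R(w)` differs from `R(w)` by a function analytic in
the disc. Integration in `w` removes that function and gives `P P = P`. The circle for `w` has
radius `r / 2` so that `w` lies strictly inside the circle defining `P`. -/
theorem rieszProjection_idem
    (hρ : ∀ ζ, ζ ≠ z₀ → dist ζ z₀ < ε → ζ ∈ resolventSet T) (hr : 0 < r) (hrε : r < ε) :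
    rieszProjection T z₀ r ∘L rieszProjection T z₀ r = rieszProjection T z₀ r := by
  have hs : 0 < r / 2 := by linarith
  have hsr : r / 2 < r := by linarith
  have hsε : r / 2 < ε := by linarith
  have hi := (continuousOn_resolventOp_sphere hρ hs hsε).circleIntegrable hs.le
  have han := analyticOnNhd_cauchyIntegral_resolventOp hρ hr hrε
  have hd : DifferentiableOn ℂ
      (fun w => residueIntegral (fun ζ => (ζ - w)⁻¹ • resolventOp T ζ) z₀ r)
      (Metric.closedBall z₀ (r / 2)) := fun z hz =>
    (han z (lt_of_le_of_lt hz hsr)).differentiableAt.differentiableWithinAt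
  have hP : rieszProjection T z₀ r = -residueIntegral (resolventOp T) z₀ (r / 2) := by
    rw [rieszProjection_eq_neg_residueIntegral, residueIntegral_resolventOp_eq hρ hr hrε hs hsε]
  have h1 := ContinuousLinearMap.residueIntegral_comp_comm
    (ContinuousLinearMap.compL ℂ E E E (rieszProjection T z₀ r)) hi
  simp only [ContinuousLinearMap.compL_apply] at h1
  nth_rewrite 2 [hP]
  rw [ContinuousLinearMap.comp_neg, ← h1, residueIntegral_congr (g := fun w => resolventOp T w -
      residueIntegral (fun ζ => (ζ - w)⁻¹ • resolventOp T ζ) z₀ r) hs.le,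
    residueIntegral_sub hi
      ((hd.continuousOn.mono Metric.sphere_subset_closedBall).circleIntegrable hs.le),
    residueIntegral_eq_zero hs.le hd, sub_zero, ← hP]
  intro w hw
  exact rieszProjection_comp_resolventOp hρ hr hrε (mem_resolventSet_of_mem_sphere hρ hs hsε hw)
    (by rwa [Metric.mem_sphere.1 hw])

/-- The Riesz projection acts on eigenvectors by a scalar Cauchy integral. -/
theorem rieszProjection_apply_eigenvector
    (hρ : ∀ ζ, ζ ≠ z₀ → dist ζ z₀ < ε → ζ ∈ resolventSet T) (hr : 0 < r) (hrε : r < ε) {l : ℂ}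
    {x : E} (hx : (x, l • x) ∈ T.graph) (hl : l ∉ Metric.sphere z₀ r) :
    rieszProjection T z₀ r x = residueIntegral (fun ζ => (ζ - l)⁻¹ • x) z₀ r := by
  have hi := (continuousOn_resolventOp_sphere hρ hr hrε).circleIntegrable hr.le
  have h1 := ContinuousLinearMap.residueIntegral_comp_comm (ContinuousLinearMap.apply ℂ E x) hi
  simp only [ContinuousLinearMap.apply_apply] at h1
  rw [rieszProjection_eq_neg_residueIntegral, neg_apply, ← h1, ← residueIntegral_neg]
  refine residueIntegral_congr hr.le fun ζ hζ => ?_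
  have hne : ζ - l ≠ 0 := fun h => hl (by rwa [← sub_eq_zero.1 h])
  have h2 := resolventOp_sub_smul (mem_resolventSet_of_mem_sphere hρ hr hrε hζ) hx
  rw [← sub_smul, map_smul, ← neg_sub, neg_smul] at h2
  nth_rewrite 2 [← h2]
  rw [smul_neg, smul_smul, inv_mul_cancel₀ hne, one_smul]

theorem rieszProjection_apply_of_mem_ker
    (hρ : ∀ ζ, ζ ≠ z₀ → dist ζ z₀ < ε → ζ ∈ resolventSet T) (hr : 0 < r) (hrε : r < ε)
    {x : E} (hx : (x, z₀ • x) ∈ T.graph) : rieszProjection T z₀ r x = x := by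
  rw [rieszProjection_apply_eigenvector hρ hr hrε hx fun h => ne_center_of_mem_sphere hr h rfl,
    residueIntegral_center_inv _ hr.ne']

/-- Either `l` is in the punctured disc, hence in the resolvent set and `x = 0`, or `l` lies outside
the circle and the scalar Cauchy kernel has no residue inside. -/
theorem rieszProjection_apply_eq_zero
    (hρ : ∀ ζ, ζ ≠ z₀ → dist ζ z₀ < ε → ζ ∈ resolventSet T) (hr : 0 < r) (hrε : r < ε) {l : ℂ}
    {x : E} (hx : (x, l • x) ∈ T.graph) (hl : l ≠ z₀) : rieszProjection T z₀ r x = 0 := by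
  by_cases hlε : dist l z₀ < ε
  · have : x = 0 := by
      rw [← resolventOp_sub_smul (hρ l hl hlε) hx, sub_self, map_zero]
    rw [this, map_zero]
  · have hlr : l ∉ Metric.closedBall z₀ r := fun h => hlε (lt_of_le_of_lt h hrε)
    rw [rieszProjection_apply_eigenvector hρ hr hrε hx fun h =>
      hlr (Metric.sphere_subset_closedBall h)]
    refine residueIntegral_eq_zero hr.le fun ζ hζ => ?_
    have hne : ζ - l ≠ 0 := fun h => hlr (by rwa [← sub_eq_zero.1 h])
    exact (((differentiableAt_id.sub_const l).inv hne).smul_const x).differentiableWithinAt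

/-- The Riesz projection commutes with `T`. -/
theorem rieszProjection_mem_graph
    (hρ : ∀ ζ, ζ ≠ z₀ → dist ζ z₀ < ε → ζ ∈ resolventSet T) (hr : 0 < r) (hrε : r < ε)
    {w : ℂ} (hw : w ∈ resolventSet T) {x y : E} (h : (x, y) ∈ T.graph) :
    (rieszProjection T z₀ r x, rieszProjection T z₀ r y) ∈ T.graph := by
  have h1 := resolventOp_sub_smul hw h
  have h2 : resolventOp T w (rieszProjection T z₀ r y - w • rieszProjection T z₀ r x) =
      rieszProjection T z₀ r x := by
    rw [← map_smul, ← map_sub, ← ContinuousLinearMap.comp_apply,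
      resolventOp_comp_rieszProjection hρ hr hrε hw, ContinuousLinearMap.comp_apply, h1]
  simpa using (resolventOp_apply_eq_iff hw).1 h2

/-- By induction `P` fixes `y = (T - z₀) x`, so `x - P x` is in `ker (T - z₀)` and is fixed by `P`.
But `P (x - P x) = 0`, hence `x = P x`. -/
theorem kerPow_le_range_rieszProjection
    (hρ : ∀ ζ, ζ ≠ z₀ → dist ζ z₀ < ε → ζ ∈ resolventSet T) (hr : 0 < r) (hrε : r < ε)
    {w : ℂ} (hw : w ∈ resolventSet T) (n : ℕ) {x : E} (hx : x ∈ kerPow T z₀ n) :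
    rieszProjection T z₀ r x = x := by
  induction n generalizing x with
  | zero =>
    rw [(Submodule.mem_bot ℂ).1 hx, map_zero]
  | succ n ih =>
    obtain ⟨y, hy, h⟩ := mem_kerPow_succ.1 hx
    have h1 := T.graph.sub_mem h (rieszProjection_mem_graph hρ hr hrε hw h)
    rw [map_add, ih hy, map_smul, Prod.mk_sub_mk, add_sub_add_left_eq_sub, ← smul_sub] at h1
    have h2 := rieszProjection_apply_of_mem_ker hρ hr hrε h1
    rw [map_sub, ← ContinuousLinearMap.comp_apply, rieszProjection_idem hρ hr hrε, sub_self] at h2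
    exact (sub_eq_zero.1 h2.symm).symm

/-- On the finite-dimensional range of the Riesz projection, `T - z₀` is a nilpotent operator. -/
theorem exists_nilpotent_of_finiteRank_rieszProjection
    (hρ : ∀ ζ, ζ ≠ z₀ → dist ζ z₀ < ε → ζ ∈ resolventSet T) (hr : 0 < r) (hrε : r < ε)
    {w : ℂ} (hw : w ∈ resolventSet T) (hP : FiniteRank (rieszProjection T z₀ r)) :
    ∃ N : Module.End ℂ (LinearMap.range (rieszProjection T z₀ r).toLinearMap),
      (∃ n, N ^ n = 0) ∧
        ∀ x : LinearMap.range (rieszProjection T z₀ r).toLinearMap,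
          ((x : E), (N x : E) + z₀ • (x : E)) ∈ T.graph := by
  set P := rieszProjection T z₀ r with hPdef
  set V := LinearMap.range P.toLinearMap
  have : FiniteDimensional ℂ V := hP
  have hPV : ∀ x ∈ V, P x = x := by
    rintro _ ⟨x, rfl⟩
    exact DFunLike.congr_fun (rieszProjection_idem hρ hr hrε) x
  have hRV : ∀ x ∈ V, resolventOp T w x ∈ V := by
    intro x hx
    rw [← hPV x hx]
    exact ⟨resolventOp T w x,
      (DFunLike.congr_fun (resolventOp_comp_rieszProjection hρ hr hrε hw) x).symm⟩
  let Rw : V →ₗ[ℂ] V := (resolventOp T w).toLinearMap.restrict hRV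
  have hinj : Function.Injective Rw := by
    rw [← LinearMap.ker_eq_bot, LinearMap.ker_eq_bot']
    intro x hx
    exact Subtype.ext (resolventOp_injective hw (congrArg Subtype.val hx))
  let e := LinearEquiv.ofInjectiveEndo Rw hinj
  -- On `V` the inverse of the resolvent is `T - w`, so `N` is `T - z₀`.
  let N : Module.End ℂ V := e.symm.toLinearMap + (w - z₀) • LinearMap.id
  have hN : ∀ x : V, ((x : E), (N x : E) + z₀ • (x : E)) ∈ T.graph := by
    intro x
    have h1 : resolventOp T w (e.symm x : V) = x := congrArg Subtype.val (e.apply_symm_apply x)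
    have h2 := (resolventOp_apply_eq_iff hw).1 h1
    have h3 : (N x : E) + z₀ • (x : E) = (e.symm x : V) + w • (x : E) := by
      simp only [N, LinearMap.add_apply, LinearMap.smul_apply, LinearMap.id_apply,
        LinearEquiv.coe_coe, Submodule.coe_add, Submodule.coe_smul]
      module
    rwa [h3]
  -- If `N v = μ v` with `μ ≠ 0`, then `T v = (μ + z₀) v`, so `P` kills `v`; but `P` is the identity
  -- on `V`.
  refine ⟨N, isNilpotent_of_forall_eigenvector N fun μ v hv hμ => ?_, hN⟩
  have h1 := hN v
  rw [hv, Submodule.coe_smul, ← add_smul] at h1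
  have h2 := rieszProjection_apply_eq_zero hρ hr hrε h1 (by simpa using hμ)
  rw [← hPdef, hPV v v.2] at h2
  exact Subtype.ext h2

theorem algebraicEigenspace_eq_range_rieszProjection
    (hρ : ∀ ζ, ζ ≠ z₀ → dist ζ z₀ < ε → ζ ∈ resolventSet T) (hr : 0 < r) (hrε : r < ε)
    {w : ℂ} (hw : w ∈ resolventSet T) (hP : FiniteRank (rieszProjection T z₀ r)) :
    algebraicEigenspace T z₀ = LinearMap.range (rieszProjection T z₀ r).toLinearMap := by
  apply le_antisymm
  · exact iSup_le fun n x hx => ⟨x, kerPow_le_range_rieszProjection hρ hr hrε hw n hx⟩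
  · obtain ⟨N, ⟨n, hn⟩, hN⟩ := exists_nilpotent_of_finiteRank_rieszProjection hρ hr hrε hw hP
    have key : ∀ (k : ℕ) (x : LinearMap.range (rieszProjection T z₀ r).toLinearMap),
        (N ^ k) x = 0 → (x : E) ∈ kerPow T z₀ k := by
      intro k
      induction k with
      | zero =>
        intro x hx
        rw [pow_zero, Module.End.one_apply] at hx
        rw [hx]
        exact zero_mem _
      | succ k ih =>
        intro x hx
        rw [pow_succ, Module.End.mul_apply] at hx
        exact mem_kerPow_succ.2 ⟨N x, ih _ hx, hN x⟩
    intro x hx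
    exact Submodule.mem_iSup_of_mem n (key n ⟨x, hx⟩ (by rw [hn]; rfl))

/-- The resolvent is finitely meromorphic at a point of the discrete spectrum. -/
theorem isFinMeroAt_resolventOp_of_finiteRank
    (hρ : ∀ ζ, ζ ≠ z₀ → dist ζ z₀ < ε → ζ ∈ resolventSet T) (hr : 0 < r) (hrε : r < ε)
    {w : ℂ} (hw : w ∈ resolventSet T) (hP : FiniteRank (rieszProjection T z₀ r)) :
    IsFinMeroAt (resolventOp T) z₀ := by
  have hex := exists_nilpotent_of_finiteRank_rieszProjection hρ hr hrε hw hP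
  set P := rieszProjection T z₀ r with hPdef
  set V := LinearMap.range P.toLinearMap
  obtain ⟨N, ⟨n, hn⟩, hN⟩ := hex
  have : FiniteDimensional ℂ V := hP
  let P' : E →L[ℂ] V := P.codRestrict V fun x => ⟨x, rfl⟩
  -- The polar coefficients are `-Nᵏ P`, from the expansion of `(N - (ζ - z₀))⁻¹`, which terminates
  -- because `N` is nilpotent.
  let c : ℕ → E →L[ℂ] E := fun k =>
    -(V.subtypeL ∘L LinearMap.toContinuousLinearMap (N ^ k) ∘L P')
  refine ⟨n, c, fun w => residueIntegral (fun ζ => (ζ - w)⁻¹ • resolventOp T ζ) z₀ r,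
    fun k _ => ?_, analyticOnNhd_cauchyIntegral_resolventOp hρ hr hrε z₀ (Metric.mem_ball_self hr),
    ?_⟩
  · exact HasFiniteRank.of_range_le V fun x => V.neg_mem (Subtype.coe_prop _)
  have hball : ∀ᶠ z in 𝓝[≠] z₀, z ∈ Metric.ball z₀ r :=
    nhdsWithin_le_nhds (Metric.ball_mem_nhds z₀ hr)
  filter_upwards [self_mem_nhdsWithin, hball] with ζ hζ hζr
  have hζρ : ζ ∈ resolventSet T := hρ ζ hζ (lt_trans hζr hrε)
  have h1 := rieszProjection_comp_resolventOp hρ hr hrε hζρ hζr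
  rw [← hPdef, eq_sub_iff_add_eq] at h1
  rw [← h1]
  congr 1
  rw [hPdef, ← resolventOp_comp_rieszProjection hρ hr hrε hζρ, ← hPdef]
  have ht : ζ - z₀ ≠ 0 := sub_ne_zero.2 hζ
  ext y
  set x : V := P' y
  let u : ℕ → V := fun m => -∑ k ∈ Finset.range m, ((ζ - z₀) ^ (k + 1))⁻¹ • (N ^ k) x
  -- The sum telescopes; at `m = n` the remainder vanishes and `u n` is the resolvent applied to
  -- `x`.
  have hu : ∀ m, N (u m) - (ζ - z₀) • u m = x - ((ζ - z₀) ^ m)⁻¹ • (N ^ m) x := by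
    intro m
    induction m with
    | zero => simp [u]
    | succ m ih =>
      have h2 : u (m + 1) = u m - ((ζ - z₀) ^ (m + 1))⁻¹ • (N ^ m) x := by
        simp only [u, Finset.sum_range_succ]
        abel
      have h3 : (ζ - z₀) • ((ζ - z₀) ^ (m + 1))⁻¹ • (N ^ m) x =
          ((ζ - z₀) ^ m)⁻¹ • (N ^ m) x := by
        rw [smul_smul]
        congr 1
        field_simp
        ring
      rw [h2, map_sub, map_smul, smul_sub, h3, ← Module.End.mul_apply, ← pow_succ']
      linear_combination (norm := module) ih
  have h2 := hu n
  rw [hn, LinearMap.zero_apply, smul_zero, sub_zero] at h2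
  have h3 := hN (u n)
  have h4 : (N (u n) : E) + z₀ • (u n : E) = (x : E) + ζ • (u n : E) := by
    have := congrArg (Subtype.val) h2
    simp only [Submodule.coe_sub, Submodule.coe_smul] at this
    rw [← this]
    module
  rw [h4] at h3
  change resolventOp T ζ (x : E) = _
  rw [(resolventOp_apply_eq_iff hζρ).2 h3]
  simp [u, c, x, Finset.sum_neg_distrib]

/-- The behaviour of the resolvent at a point that belongs to the discrete spectrum or to the
resolvent set. -/
theorem exists_resolventOp_isFinMeroAt (hz : z₀ ∈ discreteSpectrum T ∪ resolventSet T) :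
    ∃ ε > 0, (∀ ζ, ζ ≠ z₀ → dist ζ z₀ < ε → ζ ∈ resolventSet T) ∧
      IsFinMeroAt (resolventOp T) z₀ ∧ ∀ r, 0 < r → r < ε →
        HasFiniteRank (residueIntegral (resolventOp T) z₀ r) ∧
        finiteRankTrace (residueIntegral (resolventOp T) z₀ r) = -(algMult T z₀ : ℂ) := by
  rcases hz with ⟨-, ε, hε, hρ, hfr⟩ | hz
  · have hw : z₀ + (ε / 2 : ℝ) ∈ resolventSet T := by
      refine hρ _ (by simpa using hε.ne') ?_
      rw [dist_self_add_left, Complex.norm_real, Real.norm_eq_abs, abs_of_pos (by linarith)]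
      linarith
    refine ⟨ε, hε, hρ, isFinMeroAt_resolventOp_of_finiteRank hρ (half_pos hε) (half_lt_self hε) hw
      (hfr _ (half_pos hε) (half_lt_self hε)), fun r hr hrε => ?_⟩
    have hP : HasFiniteRank (rieszProjection T z₀ r) := hfr r hr hrε
    have h1 : residueIntegral (resolventOp T) z₀ r = -rieszProjection T z₀ r := by
      rw [rieszProjection_eq_neg_residueIntegral, neg_neg]
    rw [h1, finiteRankTrace_neg hP, finiteRankTrace_of_isIdempotent hP fun x =>
      DFunLike.congr_fun (rieszProjection_idem hρ hr hrε) x, algMult,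
      algebraicEigenspace_eq_range_rieszProjection hρ hr hrε hw hP]
    exact ⟨hP.neg, rfl⟩
  · obtain ⟨ε, hε, h⟩ := Metric.eventually_nhds_iff.1 (eventually_resolventOp_eq_inverse hz)
    refine ⟨ε, hε, fun ζ _ hζ => (h hζ).1, (analyticAt_resolventOp hz).isFinMeroAt,
      fun r hr hrε => ?_⟩
    rw [residueIntegral_eq_zero hr.le fun ζ hζ => (analyticAt_resolventOp
      (h (lt_of_le_of_lt hζ hrε)).1).differentiableAt.differentiableWithinAt, finiteRankTrace_zero,
      algMult, algebraicEigenspace_eq_bot hz]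
    exact ⟨hasFiniteRank_zero, by simp⟩

end RieszProjection

/-! ### Bounded operators from closed relations -/

section ClosedGraph

variable {E F : Type*} [NormedAddCommGroup E] [NormedSpace ℂ E] [CompleteSpace E]
  [NormedAddCommGroup F] [NormedSpace ℂ F] [CompleteSpace F]

/-- An everywhere defined, single-valued and closed linear relation is a bounded operator. -/
theorem exists_clm_of_closed_relation (p : E → F → Prop)
    (hadd : ∀ {x x' y y'}, p x y → p x' y' → p (x + x') (y + y'))
    (hsmul : ∀ (a : ℂ) {x y}, p x y → p (a • x) (a • y)) (hex : ∀ x, ∃ y, p x y)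
    (huniq : ∀ {y}, p 0 y → y = 0)
    (hcl : ∀ (u : ℕ → E) (v : ℕ → F) (x : E) (y : F), (∀ n, p (u n) (v n)) →
      Tendsto u atTop (𝓝 x) → Tendsto v atTop (𝓝 y) → p x y) :
    ∃ L : E →L[ℂ] F, ∀ x, p x (L x) := by
  choose L hL using hex
  have hfun : ∀ {x y}, p x y → L x = y := by
    intro x y h
    have := hadd (hL x) (hsmul (-1) h)
    rw [neg_one_smul, neg_one_smul, add_neg_cancel, ← sub_eq_add_neg] at this
    exact sub_eq_zero.1 (huniq this)
  let L' : E →ₗ[ℂ] F :=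
    { toFun := L
      map_add' := fun x y => hfun (hadd (hL x) (hL y))
      map_smul' := fun a x => hfun (hsmul a (hL x)) }
  refine ⟨⟨L', L'.continuous_of_seq_closed_graph fun u x y hu hv => ?_⟩, hL⟩
  exact (hfun (hcl u (L' ∘ u) x y (fun n => hL (u n)) hu hv)).symm

/-- A surjective bounded operator from a Hilbert space has a bounded right inverse. -/
theorem exists_clm_rightInverse {H : Type*} [NormedAddCommGroup H] [InnerProductSpace ℂ H]
    [CompleteSpace H] (a : H →L[ℂ] F) (ha : Function.Surjective a) :
    ∃ J : F →L[ℂ] H, ∀ y, a (J y) = y := by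
  have hker : IsClosed (LinearMap.ker a.toLinearMap : Set H) := a.isClosed_ker
  have : CompleteSpace (LinearMap.ker a.toLinearMap) := hker.completeSpace_coe
  -- Choosing the preimage orthogonal to the kernel makes the relation single-valued, linear and
  -- closed.
  obtain ⟨J, hJ⟩ := exists_clm_of_closed_relation
    (fun y x => a x = y ∧ x ∈ (LinearMap.ker a.toLinearMap)ᗮ)
    (fun h h' => ⟨by rw [map_add, h.1, h'.1], Submodule.add_mem _ h.2 h'.2⟩)
    (fun c _ _ h => ⟨by rw [map_smul, h.1], Submodule.smul_mem _ c h.2⟩)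
    (fun y => by
      obtain ⟨x, rfl⟩ := ha y
      refine ⟨x - (LinearMap.ker a.toLinearMap).starProjection x, ?_,
        Submodule.sub_starProjection_mem_orthogonal x⟩
      have : a ((LinearMap.ker a.toLinearMap).starProjection x) = 0 :=
        LinearMap.mem_ker.1 (Submodule.starProjection_apply_mem (LinearMap.ker a.toLinearMap) x)
      rw [map_sub, this, sub_zero])
    (fun {x} h => by
      have h1 : x ∈ LinearMap.ker a.toLinearMap := h.1
      exact inner_self_eq_zero.1 (h.2 x h1))
    (fun u v x y h hu hv => by
      refine ⟨tendsto_nhds_unique ((a.continuous.tendsto y).comp hv) ?_, ?_⟩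
      · exact hu.congr fun n => (h n).1.symm
      · exact (Submodule.isClosed_orthogonal _).mem_of_tendsto hv
          (Eventually.of_forall fun n => (h n).2))
  exact ⟨J, fun y => (hJ y).1⟩

end ClosedGraph

/-! ### Boundary triples -/

section Triples

variable {H : Type*} [NormedAddCommGroup H] [InnerProductSpace ℂ H]
variable {G : Type*} [NormedAddCommGroup G] [InnerProductSpace ℂ G]

theorem mem_graph_restrictTo {T : H →ₗ.[ℂ] H} {L : Submodule ℂ T.domain} {f f' : H} :
    (f, f') ∈ (restrictTo T L).graph ↔ ∃ x : T.domain, x ∈ L ∧ (x : H) = f ∧ T x = f' := by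
  rw [LinearPMap.mem_graph_iff]
  constructor
  · rintro ⟨⟨x, ⟨⟨u, huL, hux⟩, hx⟩⟩, hxf, hxf'⟩
    refine ⟨u, huL, hux.trans hxf, ?_⟩
    refine Eq.trans ?_ hxf'
    exact (LinearPMap.domRestrict_apply (f := T) hux.symm).symm
  · rintro ⟨u, huL, rfl, rfl⟩
    exact ⟨⟨u, ⟨⟨u, huL, rfl⟩, u.2⟩⟩, rfl, LinearPMap.domRestrict_apply (f := T) rfl⟩

namespace BoundaryTriple

variable {T : H →ₗ.[ℂ] H} (b : BoundaryTriple T G)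

/-- The relation that consists of all `(f, T f, Γ₀ f, Γ₁ f)` with `f ∈ dom T`. -/
def Rel (f f' : H) (φ ψ : G) : Prop :=
  ∃ x : T.domain, (x : H) = f ∧ T x = f' ∧ b.Γ₀ x = φ ∧ b.Γ₁ x = ψ

variable {b} {f f' g g' : H} {φ ψ φ' ψ' : G}

theorem Rel.add (h : b.Rel f f' φ ψ) (h' : b.Rel g g' φ' ψ') :
    b.Rel (f + g) (f' + g') (φ + φ') (ψ + ψ') := by
  obtain ⟨x, rfl, rfl, rfl, rfl⟩ := h
  obtain ⟨y, rfl, rfl, rfl, rfl⟩ := h'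
  exact ⟨x + y, rfl, T.map_add x y, map_add _ _ _, map_add _ _ _⟩

theorem Rel.smul (a : ℂ) (h : b.Rel f f' φ ψ) :
    b.Rel (a • f) (a • f') (a • φ) (a • ψ) := by
  obtain ⟨x, rfl, rfl, rfl, rfl⟩ := h
  exact ⟨a • x, rfl, T.map_smul a x, map_smul _ _ _, map_smul _ _ _⟩

theorem Rel.sub (h : b.Rel f f' φ ψ) (h' : b.Rel g g' φ' ψ') :
    b.Rel (f - g) (f' - g') (φ - φ') (ψ - ψ') := by
  have := h.add (h'.smul (-1))
  simpa only [neg_one_smul, ← sub_eq_add_neg] using this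

theorem Rel.boundary_eq (h : b.Rel f f' φ ψ) (h' : b.Rel f g' φ' ψ') : φ = φ' ∧ ψ = ψ' := by
  obtain ⟨x, rfl, rfl, rfl, rfl⟩ := h
  obtain ⟨y, hy, rfl, rfl, rfl⟩ := h'
  obtain rfl := Subtype.ext hy
  exact ⟨rfl, rfl⟩

theorem Rel.boundary_eq_zero (h : b.Rel 0 f' φ ψ) : φ = 0 ∧ ψ = 0 := by
  have h0 : b.Rel (0 : H) 0 0 0 := ⟨0, rfl, T.map_zero, map_zero _, map_zero _⟩
  exact h.boundary_eq h0

variable (b) in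
theorem exists_rel (φ ψ : G) : ∃ f f', b.Rel f f' φ ψ := by
  obtain ⟨x, hx⟩ := b.surjective (φ, ψ)
  exact ⟨x, T x, x, rfl, rfl, congrArg Prod.fst hx, congrArg Prod.snd hx⟩

theorem exists_rel_of_mem_graph (h : (f, f') ∈ T.graph) : ∃ φ ψ, b.Rel f f' φ ψ := by
  obtain ⟨x, hx, hx'⟩ := T.mem_graph_iff.1 h
  exact ⟨_, _, x, hx, hx', rfl, rfl⟩

theorem Rel.mem_graph (h : b.Rel f f' φ ψ) : (f, f') ∈ T.graph := by
  obtain ⟨x, rfl, rfl, -, -⟩ := h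
  exact T.mem_graph x

theorem mem_graph_extZero : (f, f') ∈ b.extZero.graph ↔ ∃ ψ, b.Rel f f' 0 ψ := by
  rw [extZero, mem_graph_restrictTo]
  constructor
  · rintro ⟨x, hx, rfl, rfl⟩
    exact ⟨_, x, rfl, rfl, hx, rfl⟩
  · rintro ⟨ψ, x, rfl, rfl, hx, -⟩
    exact ⟨x, hx, rfl, rfl⟩

theorem mem_graph_ext {Θ : G →ₗ.[ℂ] G} :
    (f, f') ∈ (b.ext Θ).graph ↔ ∃ φ ψ, b.Rel f f' φ ψ ∧ (φ, ψ) ∈ Θ.graph := by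
  rw [ext, mem_graph_restrictTo]
  constructor
  · rintro ⟨x, hx, rfl, rfl⟩
    exact ⟨_, _, ⟨x, rfl, rfl, rfl, rfl⟩, hx⟩
  · rintro ⟨φ, ψ, ⟨x, rfl, rfl, rfl, rfl⟩, hx⟩
    exact ⟨x, hx, rfl, rfl⟩

theorem Rel.green (h : b.Rel f f' φ ψ) (h' : b.Rel g g' φ' ψ') :
    inner ℂ g f' - inner ℂ g' f = inner ℂ φ' ψ - inner ℂ ψ' φ := by
  obtain ⟨x, rfl, rfl, rfl, rfl⟩ := h
  obtain ⟨y, rfl, rfl, rfl, rfl⟩ := h'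
  exact b.green x y

section Closed

variable {u u' : ℕ → H} {p q : ℕ → G}

/-- The map `Γ₀` is closed with respect to the graph norm. -/
theorem Rel.eq_of_tendsto_fst (hn : ∀ n, b.Rel (u n) (u' n) (p n) (q n))
    (hu : Tendsto u atTop (𝓝 f)) (hu' : Tendsto u' atTop (𝓝 f')) (h : b.Rel f f' φ ψ)
    (hp : Tendsto p atTop (𝓝 φ')) : φ = φ' := by
  refine ext_inner_left ℂ fun η => ?_
  -- Against an element with boundary values `(0, η)`, Green's identity expresses `⟨η, Γ₀ f⟩`
  -- through `f` and `T f` alone, which converge.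
  obtain ⟨g, g', hg⟩ := b.exists_rel 0 η
  have h1 : Tendsto (fun n => inner ℂ g (u' n) - inner ℂ g' (u n)) atTop
      (𝓝 (inner ℂ g f' - inner ℂ g' f)) :=
    (tendsto_const_nhds.inner hu').sub (tendsto_const_nhds.inner hu)
  have h2 : Tendsto (fun n => -inner ℂ η (p n)) atTop (𝓝 (-inner ℂ η φ')) :=
    (tendsto_const_nhds.inner hp).neg
  have h3 : ∀ n, inner ℂ g (u' n) - inner ℂ g' (u n) = -inner ℂ η (p n) := fun n => by
    rw [(hn n).green hg, inner_zero_left, zero_sub]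
  simp only [h3] at h1
  have h4 := tendsto_nhds_unique h1 h2
  rw [h.green hg, inner_zero_left, zero_sub] at h4
  exact neg_injective h4

/-- The map `Γ₁` is closed with respect to the graph norm. -/
theorem Rel.eq_of_tendsto_snd (hn : ∀ n, b.Rel (u n) (u' n) (p n) (q n))
    (hu : Tendsto u atTop (𝓝 f)) (hu' : Tendsto u' atTop (𝓝 f')) (h : b.Rel f f' φ ψ)
    (hq : Tendsto q atTop (𝓝 ψ')) : ψ = ψ' := by
  refine ext_inner_left ℂ fun η => ?_
  obtain ⟨g, g', hg⟩ := b.exists_rel η 0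
  have h1 : Tendsto (fun n => inner ℂ g (u' n) - inner ℂ g' (u n)) atTop
      (𝓝 (inner ℂ g f' - inner ℂ g' f)) :=
    (tendsto_const_nhds.inner hu').sub (tendsto_const_nhds.inner hu)
  have h2 : Tendsto (fun n => inner ℂ η (q n)) atTop (𝓝 (inner ℂ η ψ')) :=
    tendsto_const_nhds.inner hq
  have h3 : ∀ n, inner ℂ g (u' n) - inner ℂ g' (u n) = inner ℂ η (q n) := fun n => by
    rw [(hn n).green hg, inner_zero_left, sub_zero]
  simp only [h3] at h1
  have h4 := tendsto_nhds_unique h1 h2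
  rwa [h.green hg, inner_zero_left, sub_zero] at h4

end Closed

section Weyl

variable {z : ℂ}

/-- The difference has `Γ₀`-value zero, so it lies in the kernel of `b.extZero - z`, which is
trivial. This makes the `γ`-field and the Weyl function single-valued. -/
theorem Rel.eq_of_mem_resolventSet (hz : z ∈ resolventSet b.extZero) (h : b.Rel f (z • f) φ ψ)
    (h' : b.Rel g (z • g) φ ψ') : f = g ∧ ψ = ψ' := by
  have h1 := h.sub h'
  rw [sub_self, ← smul_sub] at h1
  have h2 := resolventOp_sub_smul hz (mem_graph_extZero.2 ⟨_, h1⟩)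
  rw [sub_self, map_zero] at h2
  rw [← h2] at h1
  exact ⟨sub_eq_zero.1 h2.symm, sub_eq_zero.1 h1.boundary_eq_zero.2⟩

/-- Any `f` with `Γ₀ f = φ` is corrected by `(A₀ - z)⁻¹ (T - z) f`, which does not change `Γ₀ f`. -/
theorem exists_rel_smul (hz : z ∈ resolventSet b.extZero) (φ : G) :
    ∃ f ψ, b.Rel f (z • f) φ ψ := by
  obtain ⟨f, f', h⟩ := b.exists_rel φ 0
  obtain ⟨ψ, h'⟩ := mem_graph_extZero.1 (mem_graph_resolventOp hz (f' - z • f))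
  have h2 := h.sub h'
  rw [sub_zero] at h2
  have h3 : f' - (f' - z • f + z • resolventOp b.extZero z (f' - z • f)) =
      z • (f - resolventOp b.extZero z (f' - z • f)) := by
    rw [smul_sub]
    abel
  rw [h3] at h2
  exact ⟨_, _, h2⟩

theorem mem_graph_weyl (hz : z ∈ resolventSet b.extZero) :
    (φ, ψ) ∈ (b.weyl z).graph ↔ ∃ f, b.Rel f (z • f) φ ψ := by
  have key : ∀ φ ψ, (φ, ψ) ∈ (LinearMap.ker (T.toFun - z • T.domain.subtype)).map
      (b.Γ₀.prod b.Γ₁) ↔ ∃ f, b.Rel f (z • f) φ ψ := by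
    intro φ ψ
    constructor
    · rintro ⟨x, hx, hxφ⟩
      exact ⟨x, x, rfl, sub_eq_zero.1 hx, congrArg Prod.fst hxφ, congrArg Prod.snd hxφ⟩
    · rintro ⟨f, x, rfl, hx, rfl, rfl⟩
      exact ⟨x, sub_eq_zero.2 hx, rfl⟩
  -- `toLinearPMap` has the given subspace as its graph only if that subspace is single-valued; this
  -- is the remaining goal.
  rw [weyl, Submodule.toLinearPMap_graph_eq, key]
  rintro ⟨φ, ψ⟩ h h0
  obtain ⟨f, hf⟩ := (key φ ψ).1 h
  rw [show φ = 0 from h0] at hf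
  have hzero : b.Rel (0 : H) (z • 0) 0 0 :=
    ⟨0, rfl, by rw [smul_zero]; exact T.map_zero, map_zero _, map_zero _⟩
  exact (hf.eq_of_mem_resolventSet hz hzero).2

theorem weyl_domain (hz : z ∈ resolventSet b.extZero) : (b.weyl z).domain = ⊤ := by
  rw [eq_top_iff]
  intro φ _
  obtain ⟨f, ψ, h⟩ := exists_rel_smul hz φ
  exact LinearPMap.mem_domain_iff.2 ⟨ψ, (mem_graph_weyl hz).2 ⟨f, h⟩⟩

theorem sub_weyl_domain {Θ : G →ₗ.[ℂ] G} (hz : z ∈ resolventSet b.extZero) :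
    (Θ - b.weyl z).domain = Θ.domain := by
  rw [LinearPMap.sub_domain, weyl_domain hz, inf_top_eq]

end Weyl

end BoundaryTriple

end Triples

/-! ### The `γ`-field, the Weyl function and Krein's resolvent formula -/

section KreinFormula

variable {H : Type*} [NormedAddCommGroup H] [InnerProductSpace ℂ H]
variable {G : Type*} [NormedAddCommGroup G] [InnerProductSpace ℂ G]
variable {T : H →ₗ.[ℂ] H}

/-- The bounded operators attached to a boundary triple and a boundary operator `Θ` at a common
point `w` of the resolvent sets: `γ(w)`, `M(w)`, `Γ₁ (A₀ - w)⁻¹`, `Γ₀ (B - w)⁻¹` and a right inverse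
of `Γ₁ (A₀ - w)⁻¹`. -/
structure BoundaryData (b : BoundaryTriple T G) (Θ : G →ₗ.[ℂ] G) where
  w : ℂ
  gammaAt : G →L[ℂ] H
  weylAt : G →L[ℂ] G
  traceOneAt : H →L[ℂ] G
  traceZeroAt : H →L[ℂ] G
  lift : G →L[ℂ] H
  mem_zero : w ∈ resolventSet b.extZero
  mem_ext : w ∈ resolventSet (b.ext Θ)
  rel_gammaAt : ∀ φ, b.Rel (gammaAt φ) (w • gammaAt φ) φ (weylAt φ)
  rel_traceOneAt : ∀ y, b.Rel (resolventOp b.extZero w y) (y + w • resolventOp b.extZero w y) 0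
    (traceOneAt y)
  rel_traceZeroAt : ∀ y, ∃ θ, b.Rel (resolventOp (b.ext Θ) w y)
    (y + w • resolventOp (b.ext Θ) w y) (traceZeroAt y) θ ∧ (traceZeroAt y, θ) ∈ Θ.graph
  traceOneAt_lift : ∀ h, traceOneAt (lift h) = h

/-- Each operator is given by an everywhere defined, single-valued relation, closed because `T` is
closed and `Γ₀`, `Γ₁` are closed in the graph norm; the closed graph theorem bounds it. The lift
exists because `Γ₁` maps `ker Γ₀` onto `G`. -/
theorem exists_boundaryData [CompleteSpace H] [CompleteSpace G] (hT : T.IsClosed)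
    (b : BoundaryTriple T G) (Θ : G →ₗ.[ℂ] G) {w : ℂ} (hw : w ∈ resolventSet b.extZero)
    (hw' : w ∈ resolventSet (b.ext Θ)) : Nonempty (BoundaryData b Θ) := by
  obtain ⟨γ, hγ⟩ := exists_clm_of_closed_relation (fun φ f => ∃ ψ, b.Rel f (w • f) φ ψ)
    (by
      rintro x x' y y' ⟨ψ, h⟩ ⟨ψ', h'⟩
      exact ⟨ψ + ψ', by rw [smul_add]; exact h.add h'⟩)
    (by
      rintro a x y ⟨ψ, h⟩
      exact ⟨a • ψ, by rw [smul_comm]; exact h.smul a⟩)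
    (fun φ => BoundaryTriple.exists_rel_smul hw φ)
    (by
      rintro y ⟨ψ, h⟩
      have h1 := resolventOp_sub_smul hw (BoundaryTriple.mem_graph_extZero.2 ⟨_, h⟩)
      rw [← h1, sub_self, map_zero])
    (by
      intro u v x y hn hu hv
      choose q hq using hn
      have hv' : Tendsto (fun n => w • v n) atTop (𝓝 (w • y)) := hv.const_smul w
      have hmem : (y, w • y) ∈ T.graph := hT.mem_of_tendsto (hv.prodMk_nhds hv')
        (Eventually.of_forall fun n => (hq n).mem_graph)
      obtain ⟨φ, ψ, h⟩ := BoundaryTriple.exists_rel_of_mem_graph (b := b) hmem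
      rw [BoundaryTriple.Rel.eq_of_tendsto_fst hq hv hv' h hu] at h
      exact ⟨ψ, h⟩)
  obtain ⟨M, hM⟩ := exists_clm_of_closed_relation (fun φ ψ => b.Rel (γ φ) (w • γ φ) φ ψ)
    (by
      intro x x' y y' h h'
      rw [map_add, smul_add]
      exact h.add h')
    (by
      intro a x y h
      rw [map_smul, smul_comm]
      exact h.smul a)
    hγ
    (by
      intro y h
      rw [map_zero] at h
      exact h.boundary_eq_zero.2)
    (by
      intro u v x y hn hu hv
      have h1 : Tendsto (fun n => γ (u n)) atTop (𝓝 (γ x)) := (γ.continuous.tendsto x).comp hu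
      obtain ⟨ψ, h⟩ := hγ x
      rw [BoundaryTriple.Rel.eq_of_tendsto_snd hn h1 (h1.const_smul w) h hv] at h
      exact h)
  set R := resolventOp b.extZero w with hR
  obtain ⟨a, ha⟩ := exists_clm_of_closed_relation
    (fun y ψ => b.Rel (R y) (y + w • R y) 0 ψ)
    (by
      intro x x' y y' h h'
      have := h.add h'
      rwa [add_zero, add_add_add_comm, ← smul_add, ← map_add] at this)
    (by
      intro a x y h
      have := h.smul a
      rwa [smul_zero, smul_add, smul_comm a w, ← map_smul] at this)
    (fun y => BoundaryTriple.mem_graph_extZero.1 (mem_graph_resolventOp hw y))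
    (by
      intro y h
      rw [map_zero] at h
      exact h.boundary_eq_zero.2)
    (by
      intro u v x y hn hu hv
      have h1 : Tendsto (fun n => R (u n)) atTop (𝓝 (R x)) := (R.continuous.tendsto x).comp hu
      obtain ⟨ψ, h⟩ := BoundaryTriple.mem_graph_extZero.1 (mem_graph_resolventOp hw x)
      rw [BoundaryTriple.Rel.eq_of_tendsto_snd hn h1 (hu.add (h1.const_smul w)) h hv] at h
      exact h)
  set R' := resolventOp (b.ext Θ) w with hR'
  obtain ⟨p, hp⟩ := exists_clm_of_closed_relation
    (fun y φ => ∃ θ, b.Rel (R' y) (y + w • R' y) φ θ ∧ (φ, θ) ∈ Θ.graph)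
    (by
      rintro x x' y y' ⟨θ, h, hθ⟩ ⟨θ', h', hθ'⟩
      have := h.add h'
      rw [add_add_add_comm, ← smul_add, ← map_add] at this
      exact ⟨_, this, Θ.graph.add_mem hθ hθ'⟩)
    (by
      rintro a x y ⟨θ, h, hθ⟩
      have := h.smul a
      rw [smul_add, smul_comm a w, ← map_smul] at this
      exact ⟨_, this, Θ.graph.smul_mem a hθ⟩)
    (fun y => BoundaryTriple.mem_graph_ext.1 (mem_graph_resolventOp hw' y))
    (by
      rintro y ⟨θ, h, -⟩
      rw [map_zero] at h
      exact h.boundary_eq_zero.1)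
    (by
      intro u v x y hn hu hv
      choose q hq hqΘ using hn
      have h1 : Tendsto (fun n => R' (u n)) atTop (𝓝 (R' x)) := (R'.continuous.tendsto x).comp hu
      obtain ⟨φ, ψ, h, hΘ⟩ := BoundaryTriple.mem_graph_ext.1 (mem_graph_resolventOp hw' x)
      have h2 := BoundaryTriple.Rel.eq_of_tendsto_fst hq h1 (hu.add (h1.const_smul w)) h hv
      subst h2
      exact ⟨ψ, h, hΘ⟩)
  have hsurj : Function.Surjective a := by
    intro ψ
    obtain ⟨f, f', h⟩ := b.exists_rel 0 ψ
    have h1 : R (f' - w • f) = f :=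
      resolventOp_sub_smul hw (BoundaryTriple.mem_graph_extZero.2 ⟨_, h⟩)
    have h2 := ha (f' - w • f)
    rw [h1] at h2
    exact ⟨f' - w • f, (h2.boundary_eq h).2⟩
  obtain ⟨J, hJ⟩ := exists_clm_rightInverse a hsurj
  exact ⟨⟨w, γ, M, a, p, J, hw, hw', hM, ha, hp, hJ⟩⟩

namespace BoundaryData

variable {b : BoundaryTriple T G} {Θ : G →ₗ.[ℂ] G} {z z' : ℂ} (D : BoundaryData b Θ)

/-- `Γ₁ (A₀ - z)⁻¹`. -/
def traceOne (z : ℂ) : H →L[ℂ] G :=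
  D.traceOneAt ∘L (ContinuousLinearMap.id ℂ H + (z - D.w) • resolventOp b.extZero z)

/-- `Γ₀ (B - z)⁻¹`. -/
def traceZero (z : ℂ) : H →L[ℂ] G :=
  D.traceZeroAt ∘L (ContinuousLinearMap.id ℂ H + (z - D.w) • resolventOp (b.ext Θ) z)

/-- The `γ`-field. -/
def gamma (z : ℂ) : G →L[ℂ] H :=
  (ContinuousLinearMap.id ℂ H + (z - D.w) • resolventOp b.extZero z) ∘L D.gammaAt

/-- The Weyl function as a bounded operator. -/
def weylOp (z : ℂ) : G →L[ℂ] G :=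
  D.weylAt + (z - D.w) • (D.traceOne z ∘L D.gammaAt)

/-- The inverse of `Θ - M(z)`. -/
def invOp (z : ℂ) : G →L[ℂ] G :=
  D.traceZero z ∘L (ContinuousLinearMap.id ℂ H - (z - D.w) • resolventOp b.extZero D.w) ∘L D.lift

/-- This transports the boundary operators from the base point `w` to `z`, so that their dependence
on `z` is that of a resolvent. -/
theorem resolventOp_apply_eq {A : H →ₗ.[ℂ] H} {w : ℂ} (hz : z ∈ resolventSet A)
    (hw : w ∈ resolventSet A) (y : H) :
    resolventOp A w (y + (z - w) • resolventOp A z y) = resolventOp A z y := by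
  have := DFunLike.congr_fun (resolventOp_sub hz hw) y
  rw [resolventOp_comm hz hw] at this
  simp only [sub_apply, smul_apply, ContinuousLinearMap.comp_apply] at this
  rw [map_add, map_smul, ← this]
  abel

theorem rel_traceOne (hz : z ∈ resolventSet b.extZero) (y : H) :
    b.Rel (resolventOp b.extZero z y) (y + z • resolventOp b.extZero z y) 0 (D.traceOne z y) := by
  have h := D.rel_traceOneAt (y + (z - D.w) • resolventOp b.extZero z y)
  rw [resolventOp_apply_eq hz D.mem_zero, add_assoc, ← add_smul, sub_add_cancel] at h
  exact h

theorem rel_traceZero (hz : z ∈ resolventSet (b.ext Θ)) (y : H) :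
    ∃ θ, b.Rel (resolventOp (b.ext Θ) z y) (y + z • resolventOp (b.ext Θ) z y)
      (D.traceZero z y) θ ∧ (D.traceZero z y, θ) ∈ Θ.graph := by
  obtain ⟨θ, h, hθ⟩ := D.rel_traceZeroAt (y + (z - D.w) • resolventOp (b.ext Θ) z y)
  rw [resolventOp_apply_eq hz D.mem_ext, add_assoc, ← add_smul, sub_add_cancel] at h
  exact ⟨θ, h, hθ⟩

theorem rel_gamma (hz : z ∈ resolventSet b.extZero) (φ : G) :
    b.Rel (D.gamma z φ) (z • D.gamma z φ) φ (D.weylOp z φ) := by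
  have h := (D.rel_gammaAt φ).add ((D.rel_traceOne hz (D.gammaAt φ)).smul (z - D.w))
  rw [smul_zero, add_zero, show D.w • D.gammaAt φ + (z - D.w) • (D.gammaAt φ +
    z • resolventOp b.extZero z (D.gammaAt φ)) = z • (D.gammaAt φ + (z - D.w) •
      resolventOp b.extZero z (D.gammaAt φ)) by module] at h
  exact h

/-- Adding `(z' - z) (A₀ - z')⁻¹ γ(z) φ` to `γ(z) φ` gives an element of `ker (T - z')` with the
same `Γ₀`-value, hence `γ(z') φ`. Comparing `Γ₁`-values gives the difference quotient of `M`. -/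
theorem weylOp_sub (hz : z ∈ resolventSet b.extZero) (hz' : z' ∈ resolventSet b.extZero) :
    D.weylOp z' = D.weylOp z + (z' - z) • (D.traceOne z' ∘L D.gamma z) := by
  ext φ
  have h := (D.rel_gamma hz φ).add ((D.rel_traceOne hz' (D.gamma z φ)).smul (z' - z))
  rw [smul_zero, add_zero, show z • D.gamma z φ + (z' - z) • (D.gamma z φ +
    z' • resolventOp b.extZero z' (D.gamma z φ)) = z' • (D.gamma z φ + (z' - z) •
      resolventOp b.extZero z' (D.gamma z φ)) by module] at h
  exact ((D.rel_gamma hz' φ).eq_of_mem_resolventSet hz' h).2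

theorem mem_graph_weyl (hz : z ∈ resolventSet b.extZero) {φ ψ : G} :
    (φ, ψ) ∈ (b.weyl z).graph ↔ D.weylOp z φ = ψ := by
  rw [BoundaryTriple.mem_graph_weyl hz]
  constructor
  · rintro ⟨f, h⟩
    exact ((D.rel_gamma hz φ).eq_of_mem_resolventSet hz h).2
  · rintro rfl
    exact ⟨_, D.rel_gamma hz φ⟩

theorem value_sub_weyl (hz : z ∈ resolventSet b.extZero) {φ : G} (hφ : φ ∈ Θ.domain) :
    value (Θ - b.weyl z) φ = Θ ⟨φ, hφ⟩ - D.weylOp z φ := by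
  have h1 : φ ∈ (Θ - b.weyl z).domain := by rwa [BoundaryTriple.sub_weyl_domain hz]
  have h2 : φ ∈ (b.weyl z).domain := by rw [BoundaryTriple.weyl_domain hz]; trivial
  rw [value, dif_pos h1, (D.mem_graph_weyl hz).1 ((b.weyl z).mem_graph ⟨φ, h2⟩)]
  exact LinearPMap.sub_apply _ _ _

theorem mem_graph_sub_weyl (hz : z ∈ resolventSet b.extZero) {φ h : G} :
    (φ, h) ∈ (Θ - b.weyl z).graph ↔ (φ, h + D.weylOp z φ) ∈ Θ.graph := by
  have hval : ∀ h1 : φ ∈ (Θ - b.weyl z).domain, ∀ hφ : φ ∈ Θ.domain,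
      (Θ - b.weyl z) ⟨φ, h1⟩ = Θ ⟨φ, hφ⟩ - D.weylOp z φ := fun h1 hφ => by
    rw [← D.value_sub_weyl hz hφ, value, dif_pos h1]
  simp only [LinearPMap.mem_graph_iff]
  constructor
  · rintro ⟨⟨x, hx⟩, hxφ, hxh⟩
    obtain rfl : x = φ := hxφ
    have hφ : x ∈ Θ.domain := by rwa [BoundaryTriple.sub_weyl_domain hz] at hx
    refine ⟨⟨x, hφ⟩, rfl, ?_⟩
    rw [hval hx hφ] at hxh
    rw [← hxh]
    abel
  · rintro ⟨⟨x, hx⟩, hxφ, hxh⟩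
    obtain rfl : x = φ := hxφ
    have hφ : x ∈ (Θ - b.weyl z).domain := by rwa [BoundaryTriple.sub_weyl_domain hz]
    refine ⟨⟨x, hφ⟩, rfl, ?_⟩
    rw [hval hφ hx, hxh]
    simp

/-- The key relations behind Krein's formula. -/
theorem krein (hz : z ∈ resolventSet b.extZero) (hz' : z ∈ resolventSet (b.ext Θ)) (y : H) :
    (D.traceZero z y, D.traceOne z y) ∈ (Θ - b.weyl z).graph ∧
      resolventOp (b.ext Θ) z y - resolventOp b.extZero z y = D.gamma z (D.traceZero z y) := by
  obtain ⟨θ, h, hθ⟩ := D.rel_traceZero hz' y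
  -- The two resolvents applied to `y` differ by an element of `ker (T - z)`, which is determined by
  -- its `Γ₀`-value.
  have h1 := h.sub (D.rel_traceOne hz y)
  rw [sub_zero, add_sub_add_left_eq_sub, ← smul_sub] at h1
  obtain ⟨h2, h3⟩ := h1.eq_of_mem_resolventSet hz (D.rel_gamma hz (D.traceZero z y))
  refine ⟨?_, h2⟩
  rw [D.mem_graph_sub_weyl hz, ← h3, add_sub_cancel]
  exact hθ

/-- Since `(I + (z - w) R(z)) (I - (z - w) R(w)) = I`, the lift at `w` becomes a right inverse of
`Γ₁ (A₀ - z)⁻¹` that is affine in `z`. It therefore adds no pole to `invOp`. -/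
theorem traceOne_comp_lift (hz : z ∈ resolventSet b.extZero) (h : G) :
    D.traceOne z ((ContinuousLinearMap.id ℂ H - (z - D.w) • resolventOp b.extZero D.w)
      (D.lift h)) = h := by
  have key : ∀ x, (ContinuousLinearMap.id ℂ H + (z - D.w) • resolventOp b.extZero z)
      ((ContinuousLinearMap.id ℂ H - (z - D.w) • resolventOp b.extZero D.w) x) = x := by
    intro x
    have := DFunLike.congr_fun (resolventOp_sub hz D.mem_zero) x
    simp only [sub_apply, smul_apply, ContinuousLinearMap.comp_apply, add_apply,
      ContinuousLinearMap.id_apply, map_sub, map_smul] at this ⊢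
    linear_combination (norm := module) (z - D.w) • this
  rw [traceOne, ContinuousLinearMap.comp_apply, key, D.traceOneAt_lift]

theorem isBoundedInverse_invOp (hz : z ∈ resolventSet b.extZero)
    (hz' : z ∈ resolventSet (b.ext Θ)) : IsBoundedInverse (Θ - b.weyl z) (D.invOp z) := by
  have hmem : ∀ h, (D.invOp z h, h) ∈ (Θ - b.weyl z).graph := by
    intro h
    have := (D.krein hz hz' ((ContinuousLinearMap.id ℂ H -
      (z - D.w) • resolventOp b.extZero D.w) (D.lift h))).1
    rwa [D.traceOne_comp_lift hz] at this
  intro φ h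
  constructor
  -- Injectivity: if `Θ φ = M(z) φ`, then `γ(z) φ` lies in `ker (B - z)`, which is trivial, so `φ =
  -- 0`.
  · intro hφ
    have h1 := (Θ - b.weyl z).graph.sub_mem (hmem h) hφ
    rw [Prod.mk_sub_mk, sub_self, D.mem_graph_sub_weyl hz, zero_add] at h1
    have h2 := D.rel_gamma hz (D.invOp z h - φ)
    have h3 := resolventOp_sub_smul hz' (BoundaryTriple.mem_graph_ext.2 ⟨_, _, h2, h1⟩)
    rw [sub_self, map_zero] at h3
    rw [← h3] at h2
    exact sub_eq_zero.1 h2.boundary_eq_zero.1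
  · rintro rfl
    exact hmem h

/-- Krein's formula. -/
theorem resolventOp_sub_resolventOp (hz : z ∈ resolventSet b.extZero)
    (hz' : z ∈ resolventSet (b.ext Θ)) :
    resolventOp (b.ext Θ) z - resolventOp b.extZero z =
      (D.gamma z ∘L D.invOp z) ∘L D.traceOne z := by
  ext y
  obtain ⟨h1, h2⟩ := D.krein hz hz' y
  rw [sub_apply, h2]
  simp only [ContinuousLinearMap.comp_apply]
  rw [(D.isBoundedInverse_invOp hz hz' _ _).1 h1]

/-! ### Analyticity and finite meromorphy of the boundary operators; the derivative of the Weyl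
function -/

section Analytic

variable [CompleteSpace H]

theorem analyticAt_id_add (A : H →ₗ.[ℂ] H) (w : ℂ) (hz : z ∈ resolventSet A) :
    AnalyticAt ℂ (fun z => ContinuousLinearMap.id ℂ H + (z - w) • resolventOp A z) z :=
  analyticAt_const.add ((analyticAt_id.sub analyticAt_const).smul (analyticAt_resolventOp hz))

theorem isFinMeroAt_id_add (A : H →ₗ.[ℂ] H) (w : ℂ) (hz : IsFinMeroAt (resolventOp A) z) :
    IsFinMeroAt (fun z => ContinuousLinearMap.id ℂ H + (z - w) • resolventOp A z) z := by
  have h1 : AnalyticAt ℂ (fun z => (z - w) • ContinuousLinearMap.id ℂ H) z :=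
    (analyticAt_id.sub analyticAt_const).smul analyticAt_const
  have h2 := (analyticAt_const (v := ContinuousLinearMap.id ℂ H) (x := z)).isFinMeroAt.add
    (hz.analytic_comp h1)
  simpa using h2

theorem analyticAt_traceOne (hz : z ∈ resolventSet b.extZero) : AnalyticAt ℂ D.traceOne z :=
  (analyticAt_const (v := D.traceOneAt)).clm_comp (analyticAt_id_add _ D.w hz)

theorem analyticAt_gamma (hz : z ∈ resolventSet b.extZero) : AnalyticAt ℂ D.gamma z :=
  (analyticAt_id_add _ D.w hz).clm_comp (analyticAt_const (v := D.gammaAt))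

theorem analyticAt_weylOp (hz : z ∈ resolventSet b.extZero) : AnalyticAt ℂ D.weylOp z :=
  analyticAt_const.add ((analyticAt_id.sub analyticAt_const).smul
    ((D.analyticAt_traceOne hz).clm_comp (analyticAt_const (v := D.gammaAt))))

theorem analyticAt_lift : AnalyticAt ℂ (fun z =>
    (ContinuousLinearMap.id ℂ H - (z - D.w) • resolventOp b.extZero D.w) ∘L D.lift) z :=
  (analyticAt_const.sub ((analyticAt_id.sub analyticAt_const).smul analyticAt_const)).clm_comp
    (analyticAt_const (v := D.lift))

theorem analyticAt_invOp (hz : z ∈ resolventSet (b.ext Θ)) : AnalyticAt ℂ D.invOp z :=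
  ((analyticAt_const (v := D.traceZeroAt)).clm_comp (analyticAt_id_add _ D.w hz)).clm_comp
    D.analyticAt_lift

theorem isFinMeroAt_traceOne [CompleteSpace G] (hz : IsFinMeroAt (resolventOp b.extZero) z) :
    IsFinMeroAt D.traceOne z :=
  (isFinMeroAt_id_add _ D.w hz).analytic_comp (analyticAt_const (v := D.traceOneAt))

theorem isFinMeroAt_gamma (hz : IsFinMeroAt (resolventOp b.extZero) z) :
    IsFinMeroAt D.gamma z :=
  (isFinMeroAt_id_add _ D.w hz).comp (analyticAt_const (v := D.gammaAt)).isFinMeroAt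

theorem isFinMeroAt_invOp [CompleteSpace G] (hz : IsFinMeroAt (resolventOp (b.ext Θ)) z) :
    IsFinMeroAt D.invOp z :=
  ((isFinMeroAt_id_add _ D.w hz).analytic_comp (analyticAt_const (v := D.traceZeroAt))).comp
    D.analyticAt_lift.isFinMeroAt

theorem hasDerivAt_weylOp (hz : z ∈ resolventSet b.extZero) :
    HasDerivAt D.weylOp (D.traceOne z ∘L D.gamma z) z := by
  have h1 : HasDerivAt (fun z' : ℂ => z' - z) 1 z := (hasDerivAt_id z).sub_const z
  have h2 := ((D.analyticAt_traceOne hz).clm_comp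
    (analyticAt_const (v := D.gamma z))).differentiableAt.hasDerivAt
  have h3 := (h1.smul h2).const_add (D.weylOp z)
  simp only [sub_self, zero_smul, zero_add, one_smul] at h3
  refine h3.congr_of_eventuallyEq ?_
  filter_upwards [eventually_resolventOp_eq_inverse hz] with z' hz'
  exact D.weylOp_sub hz hz'.1

theorem hasDerivAt_value_sub_weyl (hz : z ∈ resolventSet b.extZero) {φ : G}
    (hφ : φ ∈ Θ.domain) :
    HasDerivAt (fun w => value (Θ - b.weyl w) φ) (-(D.traceOne z ∘L D.gamma z) φ) z := by
  have h1 : HasDerivAt (fun w => D.weylOp w φ) ((D.traceOne z ∘L D.gamma z) φ) z :=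
    (ContinuousLinearMap.apply ℂ G φ).hasFDerivAt.comp_hasDerivAt z (D.hasDerivAt_weylOp hz)
  refine (h1.const_sub (Θ ⟨φ, hφ⟩)).congr_of_eventuallyEq ?_
  filter_upwards [eventually_resolventOp_eq_inverse hz] with z' hz'
  exact D.value_sub_weyl hz'.1 hφ

theorem isDerivClosure (hz : z ∈ resolventSet b.extZero) :
    IsDerivClosure (fun z => Θ - b.weyl z) z (-(D.traceOne z ∘L D.gamma z)) := by
  intro φ hφ
  rw [BoundaryTriple.sub_weyl_domain hz] at hφ
  exact (D.hasDerivAt_value_sub_weyl hz hφ).deriv.symm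

/-- `derivClosure` is an arbitrary choice among continuations; density of the domain leaves only
one. -/
theorem derivClosure_eq (hΘ : Dense (Θ.domain : Set G)) (hz : z ∈ resolventSet b.extZero) :
    derivClosure (fun z => Θ - b.weyl z) z = -(D.traceOne z ∘L D.gamma z) := by
  have hD : ∃ L, IsDerivClosure (fun z => Θ - b.weyl z) z L := ⟨_, D.isDerivClosure hz⟩
  rw [derivClosure, dif_pos hD]
  refine ContinuousLinearMap.ext fun x => ?_
  refine congrFun (Continuous.ext_on hΘ (ContinuousLinearMap.continuous _)
    (ContinuousLinearMap.continuous _) fun φ hφ => ?_) x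
  have hφ' : φ ∈ (Θ - b.weyl z).domain := by rw [BoundaryTriple.sub_weyl_domain hz]; exact hφ
  rw [hD.choose_spec φ hφ', D.isDerivClosure hz φ hφ']

end Analytic

end BoundaryData

end KreinFormula

/-! ### The index hypothesis and the evaluation of the index -/

section MainResult

variable {H : Type*} [NormedAddCommGroup H] [InnerProductSpace ℂ H] [CompleteSpace H]
variable {G : Type*} [NormedAddCommGroup G] [InnerProductSpace ℂ G] [CompleteSpace G]

theorem isClosed_of_boundedlyInvertible {E : Type*} [NormedAddCommGroup E]
    [InnerProductSpace ℂ E] {A : E →ₗ.[ℂ] E} (h : BoundedlyInvertible A) : A.IsClosed := by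
  obtain ⟨R, hR⟩ := h
  have : (A.graph : Set (E × E)) = {p | R p.2 = p.1} := by
    ext ⟨x, y⟩
    exact hR x y
  rw [LinearPMap.IsClosed, this]
  exact isClosed_eq (R.continuous.comp continuous_snd) continuous_fst

namespace BoundaryData

variable {T : H →ₗ.[ℂ] H} {b : BoundaryTriple T G} {Θ : G →ₗ.[ℂ] G}
  {z₀ : ℂ} {ε₀ : ℝ}

theorem indexHypothesis (D : BoundaryData b Θ) (hΘ : Dense (Θ.domain : Set G)) (hε₀ : 0 < ε₀)
    (hA : ∀ z, z ≠ z₀ → dist z z₀ < ε₀ → z ∈ resolventSet b.extZero)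
    (hB : ∀ z, z ≠ z₀ → dist z z₀ < ε₀ → z ∈ resolventSet (b.ext Θ))
    (hmA : IsFinMeroAt (resolventOp b.extZero) z₀)
    (hmB : IsFinMeroAt (resolventOp (b.ext Θ)) z₀) :
    IndexHypothesis (Metric.ball z₀ ε₀) {z₀} (fun z => Θ - b.weyl z) := by
  have hA' : ∀ z ∈ Metric.ball z₀ ε₀ \ {z₀}, z ∈ resolventSet b.extZero :=
    fun z hz => hA z hz.2 hz.1
  have hB' : ∀ z ∈ Metric.ball z₀ ε₀ \ {z₀}, z ∈ resolventSet (b.ext Θ) :=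
    fun z hz => hB z hz.2 hz.1
  have hopen : IsOpen (Metric.ball z₀ ε₀ \ {z₀}) := Metric.isOpen_ball.sdiff isClosed_singleton
  have hinv : ∀ z ∈ Metric.ball z₀ ε₀ \ {z₀}, boundedInverse (Θ - b.weyl z) = D.invOp z :=
    fun z hz => (D.isBoundedInverse_invOp (hA' z hz) (hB' z hz)).boundedInverse_eq
  have hder : ∀ z ∈ Metric.ball z₀ ε₀ \ {z₀}, derivClosure (fun z => Θ - b.weyl z) z =
      -(D.traceOne z ∘L D.gamma z) := fun z hz => D.derivClosure_eq hΘ (hA' z hz)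
  have hpunct : ∀ᶠ z in 𝓝[≠] z₀, z ∈ Metric.ball z₀ ε₀ \ {z₀} :=
    inter_mem (nhdsWithin_le_nhds (Metric.ball_mem_nhds z₀ hε₀)) self_mem_nhdsWithin
  have hinvA : AnalyticOnNhd ℂ (fun z => boundedInverse (Θ - b.weyl z))
      (Metric.ball z₀ ε₀ \ {z₀}) := fun z hz => by
    refine (D.analyticAt_invOp (hB' z hz)).congr ?_
    filter_upwards [hopen.mem_nhds hz] with w hw using (hinv w hw).symm
  have hderA : AnalyticOnNhd ℂ (derivClosure (fun z => Θ - b.weyl z))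
      (Metric.ball z₀ ε₀ \ {z₀}) := fun z hz => by
    refine ((D.analyticAt_traceOne (hA' z hz)).clm_comp
      (D.analyticAt_gamma (hA' z hz))).neg.congr ?_
    filter_upwards [hopen.mem_nhds hz] with w hw using (hder w hw).symm
  have hbdd : ∀ z ∈ Metric.ball z₀ ε₀ \ {z₀}, BoundedlyInvertible (Θ - b.weyl z) :=
    fun z hz => ⟨_, D.isBoundedInverse_invOp (hA' z hz) (hB' z hz)⟩
  refine
    { isOpen := Metric.isOpen_ball
      isConnected := Metric.isConnected_ball hε₀
      subset := by simpa using hε₀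
      discrete := fun z _ h => ?_
      closed := fun z hz => isClosed_of_boundedlyInvertible (hbdd z hz)
      dense := fun z hz => by rwa [BoundaryTriple.sub_weyl_domain (hA' z hz)]
      domain_eq := fun z hz w hw => by
        rw [BoundaryTriple.sub_weyl_domain (hA' z hz), BoundaryTriple.sub_weyl_domain (hA' w hw)]
      invertible := hbdd
      inv_analytic := hinvA
      inv_finMero := fun z hz => ?_
      analytic := fun φ hφ z hz => ?_
      deriv_bounded := fun z hz => ⟨_, D.isDerivClosure (hA' z hz)⟩
      deriv_analytic := hderA
      deriv_finMero := fun z hz => ?_ }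
  · exact Set.Infinite.of_accPt h (Set.finite_singleton z₀)
  · rcases eq_or_ne z z₀ with rfl | hne
    -- For equal source and target, `IsFinMeroAt` unfolds to `FinitelyMeromorphicAt`. Only the
    -- punctured disc matters, so the value at `z₀` is irrelevant.
    · exact (D.isFinMeroAt_invOp hmB).congr (hpunct.mono hinv)
    · exact (hinvA z ⟨hz, hne⟩).isFinMeroAt
  · have hφ' : φ ∈ Θ.domain := by
      rw [← BoundaryTriple.sub_weyl_domain (Θ := Θ) (hA' z hz)]
      exact hφ z hz
    have h1 : AnalyticAt ℂ (fun w => D.weylOp w φ) z :=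
      ((ContinuousLinearMap.apply ℂ G φ).analyticAt _).comp (D.analyticAt_weylOp (hA' z hz))
    refine ((analyticAt_const (v := Θ ⟨φ, hφ'⟩)).sub h1).congr ?_
    filter_upwards [hopen.mem_nhds hz] with w hw using (D.value_sub_weyl (hA' w hw) hφ').symm
  · rcases eq_or_ne z z₀ with rfl | hne
    · exact ((D.isFinMeroAt_traceOne hmA).comp (D.isFinMeroAt_gamma hmA)).neg.congr
        (hpunct.mono hder)
    · exact (hderA z ⟨hz, hne⟩).isFinMeroAt

/-- The trace of the index operator is the difference of the traces of the residues of the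
resolvents. -/
theorem finiteRank_indexOperator (D : BoundaryData b Θ) (hΘ : Dense (Θ.domain : Set G))
    (hε₀ : 0 < ε₀)
    (hA : ∀ z, z ≠ z₀ → dist z z₀ < ε₀ → z ∈ resolventSet b.extZero)
    (hB : ∀ z, z ≠ z₀ → dist z z₀ < ε₀ → z ∈ resolventSet (b.ext Θ))
    (hmA : IsFinMeroAt (resolventOp b.extZero) z₀)
    (hmB : IsFinMeroAt (resolventOp (b.ext Θ)) z₀) {mA mB : ℂ}
    (hrA : ∀ r, 0 < r → r < ε₀ → HasFiniteRank (residueIntegral (resolventOp b.extZero) z₀ r) ∧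
      finiteRankTrace (residueIntegral (resolventOp b.extZero) z₀ r) = -mA)
    (hrB : ∀ r, 0 < r → r < ε₀ →
      HasFiniteRank (residueIntegral (resolventOp (b.ext Θ)) z₀ r) ∧
      finiteRankTrace (residueIntegral (resolventOp (b.ext Θ)) z₀ r) = -mB)
    {ε : ℝ} (hε : 0 < ε) (hεε₀ : ε < ε₀) :
    FiniteRank (indexOperator (fun z => Θ - b.weyl z) z₀ ε) ∧
      generalizedIndex (fun z => Θ - b.weyl z) z₀ ε = mB - mA := by
  let c : ℂ → G →L[ℂ] H := fun z => D.gamma z ∘L D.invOp z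
  have hc : IsFinMeroAt c z₀ := (D.isFinMeroAt_gamma hmA).comp (D.isFinMeroAt_invOp hmB)
  -- The traces are compared on a small circle of radius `r`, where the local Laurent expansions
  -- hold; `h2` moves the contour there from radius `ε`.
  obtain ⟨r, ⟨hfr, -, htr⟩, hr, hrε₀⟩ :=
    (((D.isFinMeroAt_traceOne hmA).eventually_residueTraceComm hc).and
      (Ioo_mem_nhdsGT hε₀)).exists
  have h1 : indexOperator (fun z => Θ - b.weyl z) z₀ ε =
      -residueIntegral (fun z => D.traceOne z ∘L c z) z₀ ε := by
    rw [← residueIntegral_neg]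
    refine residueIntegral_congr hε.le fun z hz => ?_
    have hzA := mem_resolventSet_of_mem_sphere hA hε hεε₀ hz
    have hzB := mem_resolventSet_of_mem_sphere hB hε hεε₀ hz
    rw [D.derivClosure_eq hΘ hzA, (D.isBoundedInverse_invOp hzA hzB).boundedInverse_eq]
    rfl
  have h2 : residueIntegral (fun z => D.traceOne z ∘L c z) z₀ ε =
      residueIntegral (fun z => D.traceOne z ∘L c z) z₀ r :=
    residueIntegral_eq_of_differentiableOn (fun z hz hzε =>
      ((D.analyticAt_traceOne (hA z hz hzε)).clm_comp ((D.analyticAt_gamma (hA z hz hzε)).clm_comp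
        (D.analyticAt_invOp (hB z hz hzε)))).differentiableAt) hε hεε₀ hr hrε₀
  -- In the reversed order the product is the right-hand side of Krein's formula.
  have h3 : residueIntegral (fun z => c z ∘L D.traceOne z) z₀ r =
      residueIntegral (resolventOp (b.ext Θ)) z₀ r +
        -residueIntegral (resolventOp b.extZero) z₀ r := by
    rw [← sub_eq_add_neg, ← residueIntegral_sub
      ((continuousOn_resolventOp_sphere hB hr hrε₀).circleIntegrable hr.le)
      ((continuousOn_resolventOp_sphere hA hr hrε₀).circleIntegrable hr.le)]
    refine residueIntegral_congr hr.le fun z hz => ?_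
    exact (D.resolventOp_sub_resolventOp (mem_resolventSet_of_mem_sphere hA hr hrε₀ hz)
      (mem_resolventSet_of_mem_sphere hB hr hrε₀ hz)).symm
  obtain ⟨hfA, htA⟩ := hrA r hr hrε₀
  obtain ⟨hfB, htB⟩ := hrB r hr hrε₀
  unfold generalizedIndex
  rw [h1, h2]
  refine ⟨hfr.neg, ?_⟩
  rw [finiteRankTrace_neg hfr, htr, h3, finiteRankTrace_add hfB hfA.neg, finiteRankTrace_neg hfA,
    htA, htB]
  ring

end BoundaryData

end MainResult

end GenIndex

end

theorem corollary4p4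
    {H : Type*} [NormedAddCommGroup H] [InnerProductSpace ℂ H] [CompleteSpace H]
    [TopologicalSpace.SeparableSpace H]
    {G : Type*} [NormedAddCommGroup G] [InnerProductSpace ℂ G] [CompleteSpace G]
    (A₀ B₂ S : H →ₗ.[ℂ] H)
    (hA₀ : IsSelfAdjoint A₀) (hB₂ : B₂.IsClosed)
    (hS : S = A₀ ⊓ B₂) (hSdense : Dense (S.domain : Set H))
    (hS' : S = A₀ ⊓ B₂.adjoint)
    (b : GenIndex.BoundaryTriple S.adjoint G)
    (Θ₂ : G →ₗ.[ℂ] G) (hΘclosed : Θ₂.IsClosed) (hΘdense : Dense (Θ₂.domain : Set G))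
    (hbA₀ : A₀ = b.extZero) (hbB₂ : B₂ = b.ext Θ₂)
    (z₀ : ℂ)
    (hzB₂ : z₀ ∈ GenIndex.discreteSpectrum B₂ ∪ GenIndex.resolventSet B₂)
    (hzA₀ : z₀ ∈ GenIndex.discreteSpectrum A₀ ∪ GenIndex.resolventSet A₀) :
    ∃ ε₀ > 0,
      GenIndex.IndexHypothesis (Metric.ball z₀ ε₀) {z₀} (fun z => Θ₂ - b.weyl z) ∧
      ∀ ε, 0 < ε → ε < ε₀ →
        GenIndex.FiniteRank (GenIndex.indexOperator (fun z => Θ₂ - b.weyl z) z₀ ε) ∧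
        GenIndex.generalizedIndex (fun z => Θ₂ - b.weyl z) z₀ ε =
          (GenIndex.algMult B₂ z₀ : ℂ) - (GenIndex.algMult A₀ z₀ : ℂ) := by

  subst hbA₀ hbB₂
  obtain ⟨εA, hεA, hA, hmA, hrA⟩ := GenIndex.exists_resolventOp_isFinMeroAt hzA₀
  obtain ⟨εB, hεB, hB, hmB, hrB⟩ := GenIndex.exists_resolventOp_isFinMeroAt hzB₂
  have hε₀ : 0 < min εA εB := lt_min hεA hεB
  have hA' : ∀ z, z ≠ z₀ → dist z z₀ < min εA εB → z ∈ GenIndex.resolventSet b.extZero :=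
    fun z hz h => hA z hz (h.trans_le (min_le_left _ _))
  have hB' : ∀ z, z ≠ z₀ → dist z z₀ < min εA εB → z ∈ GenIndex.resolventSet (b.ext Θ₂) :=
    fun z hz h => hB z hz (h.trans_le (min_le_right _ _))
  -- The base point must lie in both resolvent sets, and `z₀` itself may be in neither.
  have hw : z₀ + (min εA εB / 2 : ℝ) ≠ z₀ := by simpa using hε₀.ne'
  have hw' : dist (z₀ + (min εA εB / 2 : ℝ)) z₀ < min εA εB := by
    rw [dist_self_add_left, Complex.norm_real, Real.norm_eq_abs, abs_of_pos (half_pos hε₀)]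
    exact half_lt_self hε₀
  obtain ⟨D⟩ := GenIndex.exists_boundaryData (LinearPMap.adjoint_isClosed hSdense) b Θ₂
    (hA' _ hw hw') (hB' _ hw hw')
  refine ⟨min εA εB, hε₀, D.indexHypothesis hΘdense hε₀ hA' hB' hmA hmB, fun ε hε hεε₀ => ?_⟩
  exact D.finiteRank_indexOperator hΘdense hε₀ hA' hB' hmA hmB
    (fun r hr h => hrA r hr (h.trans_le (min_le_left _ _)))
    (fun r hr h => hrB r hr (h.trans_le (min_le_right _ _))) hε hεε₀
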